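/- Let $p\ge 3$ and $n\ge 1$, and let $M=(m_{ij})$ be a fixed real symmetric $p\times p$ matrix (the mask). Let $x=(X_1,\dots,X_p)^*$ be a random vector in $\mathbb{R}^p$ with mean zero and finite fourth moments, and let $x_1,\dots,x_n$ be independent random vectors with the same distribution as $x$. Put $\Sigma=\mathbb{E}(xx^*)$ and $\widehat\Sigma_n=\frac1n\sum_{i=1}^n x_ix_i^*$, and let $\odot$ denote the entrywise product of matrices. Write $\|\cdot\|$ for the Euclidean norm of a vector and for the spectral norm (the operator norm induced by it) of a matrix, $\|\cdot\|_\infty$ for the maximum absolute entry of a vector, and $\|M\|_{1\to2}=\max_j\big(\sum_i m_{ij}^2\big)^{1/2}$. For $r\ge1$ let $$\mu_r=\max_{1\le j\le p}\big(\mathbb{E}|X_j|^r\big)^{1/r}\in[0,\infty],\qquad \nu=\sup_{\|u\|=1}\big(\mathbb{E}|u^*x|^4\big)^{1/4}.$$ Then $$\Big[\mathbb{E}\,\big\|M\odot\widehat\Sigma_n-M\odot\Sigma\big\|^2\Big]^{1/2}\le\sqrt{\frac{8e\log p}{n}}\;\|M\|_{1\to2}\;\mu_4\,\nu+\frac{8e\log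 p}{n}\;\|M\|\,\Big[\mathbb{E}\max_{1\le i\le n}\|x_i\|_\infty^4\Big]^{1/2}.$$ Furthermore, $$\Big[\mathbb{E}\max_{1\le i\le n}\|x_i\|_\infty^4\Big]^{1/2}\le\inf_{r\ge1}\,(np)^{1/(2r)}\,\mu_{4r}^2,$$ where the infimum is over all real $r\ge1$. -/

import Mathlib

open MeasureTheory ProbabilityTheory
open scoped ENNReal Matrix
-- On matrices, `‖A‖` is the spectral norm, i.e. the operator norm induced by the Euclidean norm.
open scoped Matrix.Norms.L2Operator

namespace MaskedCov

variable {p n : ℕ} {Ω : Type*} [MeasurableSpace Ω]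

/-- The covariance matrix `Σ = E (x xᵀ)` of a mean-zero random vector `x` (entrywise expectation). -/
noncomputable def covMatrix (x : Ω → Fin p → ℝ) (P : Measure Ω) : Matrix (Fin p) (Fin p) ℝ :=
  Matrix.of fun j k => ∫ ω, x ω j * x ω k ∂P

/-- The sample covariance matrix `(1 / n) ∑ i, v i (v i)ᵀ` of the vectors `v 0, …, v (n - 1)`. -/
noncomputable def sampleCov (v : Fin n → Fin p → ℝ) : Matrix (Fin p) (Fin p) ℝ :=
  (1 / (n : ℝ)) • ∑ i, Matrix.vecMulVec (v i) (v i)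

/-- The norm `‖A‖_{1→2}`: the maximal Euclidean norm of a column of `A`. -/
noncomputable def normOneTwo (A : Matrix (Fin p) (Fin p) ℝ) : ℝ :=
  ⨆ j, Real.sqrt (∑ i, A i j ^ 2)

/-- The `r`-th diagonal moment `μ_r(x) = max_j (E |x_j| ^ r) ^ (1 / r)`, with values in `[0, ∞]`. -/
noncomputable def diagMoment (x : Ω → Fin p → ℝ) (P : Measure Ω) (r : ℝ) : ℝ≥0∞ :=
  ⨆ j, (∫⁻ ω, ‖x ω j‖ₑ ^ r ∂P) ^ (1 / r)

/-- The uniform fourth moment `ν(x) = sup_{‖u‖₂ = 1} (E |uᵀ x| ^ 4) ^ (1 / 4)`,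
with values in `[0, ∞]`. -/
noncomputable def unifFourthMoment (x : Ω → Fin p → ℝ) (P : Measure Ω) : ℝ≥0∞ :=
  ⨆ (u : EuclideanSpace ℝ (Fin p)) (_ : ‖u‖ = 1),
    (∫⁻ ω, ‖∑ j, u j * x ω j‖ₑ ^ 4 ∂P) ^ (1 / 4 : ℝ)

/-- The expectation `E max_i ‖x_i‖_∞ ^ 4`, with values in `[0, ∞]`.
The norm of `Fin p → ℝ` is the maximum norm. -/
noncomputable def expMaxFourth (X : Fin n → Ω → Fin p → ℝ) (P : Measure Ω) : ℝ≥0∞ :=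
  ∫⁻ ω, ⨆ i, ‖X i ω‖ₑ ^ 4 ∂P

end MaskedCov

/-! The estimation error is (1/n) ∑ (Z(x_i) - E Z), where Z(y) = M ⊙ yyᵀ = diag(y) M diag(y) is
symmetric, so the first bound is a matrix Rosenthal inequality applied to Z. Put c = 2e log p.

The engine is a Khintchine inequality: over random signs, the mean of ‖∑ ε_i A_i‖² is at most c ‖∑
A_i²‖. Flipping the single sign ε_i changes the series S by 2 ε_i A_i, and `trace_gm_am` then gives
mean tr S^(2m+2) ≤ (2m+1) ‖∑ A_i²‖ · mean tr S^(2m). Iterating up to order about log p reduces the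
dimension factor of the trace to e.

Symmetrization and Khintchine bound E‖∑ (Z_i - E Z)‖² by 4c·I with I = E‖∑ Z_i²‖. Centering ∑ Z_i²,
symmetrizing once more and using ‖∑ Z_i⁴‖ ≤ max ‖Z_i‖² · ‖∑ Z_i²‖ gives I ≤ a + b√I with a = n‖E Z²‖
and b = 2 √c (E max ‖Z_i‖²)^(1/2), whence √I ≤ √a + b. This is `matrix_rosenthal`.

It remains to insert ‖Z(y)‖ ≤ ‖M‖ ‖y‖_∞² and ‖E Z²‖ ≤ (‖M‖_{1→2} μ_4 ν)². The second bound is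
Jensen's inequality, with the maximum replaced by a sum over np coordinates. -/

namespace MaskedCov

/-! ### Spectral norm and trace inequalities for real symmetric matrices -/

section SymmetricMatrix

theorem sum_mul_self_isSymm {d ι : Type*} [Fintype d] [Fintype ι] {A : ι → Matrix d d ℝ}
    (hA : ∀ i, (A i).IsSymm) : (∑ i, A i * A i).IsSymm := by
  simp [Matrix.IsSymm, Matrix.transpose_sum, Matrix.transpose_mul, (hA _).eq]

theorem quadForm_mul_self {d : Type*} [Fintype d] {A : Matrix d d ℝ} (hA : A.IsSymm) (u : d → ℝ) :
    u ⬝ᵥ ((A * A) *ᵥ u) = (A *ᵥ u) ⬝ᵥ (A *ᵥ u) := by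
  rw [← Matrix.mulVec_mulVec, Matrix.dotProduct_mulVec, ← Matrix.mulVec_transpose, hA.eq]

theorem isSymm_units_smul {d : Type*} {A : Matrix d d ℝ} (hA : A.IsSymm) (s : ℤˣ) :
    (s • A).IsSymm := by
  rcases Int.units_eq_one_or s with rfl | rfl
  · simpa using hA
  · simpa [Units.neg_smul, Matrix.IsSymm] using hA.eq

theorem isSymm_rademacher_sum {d ι : Type*} [Fintype ι] {A : ι → Matrix d d ℝ}
    (hA : ∀ i, (A i).IsSymm) (s : ι → ℤˣ) :
    (∑ i, s i • A i).IsSymm := by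
  rw [Matrix.IsSymm, Matrix.transpose_sum]
  exact Finset.sum_congr rfl fun i _ => (isSymm_units_smul (hA i) _).eq

variable {d : Type*} [Fintype d] [DecidableEq d]

theorem dotProduct_mulVec_self_le (A : Matrix d d ℝ) (u : d → ℝ) :
    (A *ᵥ u) ⬝ᵥ (A *ᵥ u) ≤ ‖A‖ ^ 2 * (u ⬝ᵥ u) := by
  have key : ∀ v : d → ℝ, v ⬝ᵥ v = ‖WithLp.toLp 2 v‖ ^ 2 := fun v => by
    rw [EuclideanSpace.real_norm_sq_eq]; simp [dotProduct, sq]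
  rw [key, key, ← mul_pow]
  exact pow_le_pow_left₀ (norm_nonneg _) (Matrix.l2_opNorm_mulVec A (WithLp.toLp 2 u)) 2

theorem dotProduct_mulVec_le (A : Matrix d d ℝ) (u : d → ℝ) :
    u ⬝ᵥ (A *ᵥ u) ≤ ‖A‖ * (u ⬝ᵥ u) := by
  have h1 : (u ⬝ᵥ (A *ᵥ u)) ^ 2 ≤ (u ⬝ᵥ u) * ((A *ᵥ u) ⬝ᵥ (A *ᵥ u)) := by
    simpa [dotProduct, sq] using Finset.sum_mul_sq_le_sq_mul_sq Finset.univ u (A *ᵥ u)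
  have h2 := dotProduct_mulVec_self_le A u
  have h0 : 0 ≤ u ⬝ᵥ u := Finset.sum_nonneg fun i _ => mul_self_nonneg _
  refine abs_le_of_sq_le_sq' ?_ (mul_nonneg (norm_nonneg _) h0) |>.2
  nlinarith [mul_le_mul_of_nonneg_left h2 h0]

theorem _root_.Matrix.IsSymm.exists_diagonalization {A : Matrix d d ℝ} (hA : A.IsSymm) :
    ∃ (U : Matrix d d ℝ) (v : d → ℝ), U * Uᵀ = 1 ∧ Uᵀ * U = 1 ∧
      A = U * Matrix.diagonal v * Uᵀ := by
  have hH : A.IsHermitian := by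
    rw [Matrix.IsHermitian, Matrix.conjTranspose_eq_transpose_of_trivial]; exact hA
  refine ⟨hH.eigenvectorUnitary, hH.eigenvalues, ?_, ?_, ?_⟩
  · simpa [Matrix.star_eq_conjTranspose, Matrix.conjTranspose_eq_transpose_of_trivial] using
      Unitary.coe_mul_star_self hH.eigenvectorUnitary
  · simpa [Matrix.star_eq_conjTranspose, Matrix.conjTranspose_eq_transpose_of_trivial] using
      Unitary.coe_star_mul_self hH.eigenvectorUnitary
  · have := hH.spectral_theorem
    rw [Unitary.conjStarAlgAut_apply] at this
    simpa [Matrix.star_eq_conjTranspose, Matrix.conjTranspose_eq_transpose_of_trivial,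
      Function.comp_def] using this

theorem norm_orthogonal_conj {U : Matrix d d ℝ} (h1 : U * Uᵀ = 1) (h2 : Uᵀ * U = 1)
    (B : Matrix d d ℝ) : ‖U * B * Uᵀ‖ = ‖B‖ := by
  have hU : U ∈ unitary (Matrix d d ℝ) := by
    simp [Unitary.mem_iff, Matrix.star_eq_conjTranspose,
      Matrix.conjTranspose_eq_transpose_of_trivial, h1, h2]
  have hU' : Uᵀ ∈ unitary (Matrix d d ℝ) := by
    simp [Unitary.mem_iff, Matrix.star_eq_conjTranspose,
      Matrix.conjTranspose_eq_transpose_of_trivial, h1, h2]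
  rw [CStarRing.norm_mul_mem_unitary _ hU', CStarRing.norm_mem_unitary_mul _ hU]

theorem norm_eq_of_diagonalization {A U : Matrix d d ℝ} {v : d → ℝ} (h1 : U * Uᵀ = 1)
    (h2 : Uᵀ * U = 1) (h : A = U * Matrix.diagonal v * Uᵀ) : ‖A‖ = ‖v‖ := by
  rw [h, norm_orthogonal_conj h1 h2, Matrix.l2_opNorm_diagonal]

theorem pow_of_diagonalization {A U : Matrix d d ℝ} {v : d → ℝ} (h1 : U * Uᵀ = 1)
    (h2 : Uᵀ * U = 1) (h : A = U * Matrix.diagonal v * Uᵀ) (k : ℕ) :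
    A ^ k = U * Matrix.diagonal (fun i => v i ^ k) * Uᵀ := by
  induction k with
  | zero => simp [h1]
  | succ k ih =>
    rw [pow_succ, ih, h]
    calc U * Matrix.diagonal (fun i => v i ^ k) * Uᵀ * (U * Matrix.diagonal v * Uᵀ)
        = U * (Matrix.diagonal (fun i => v i ^ k) * (Uᵀ * U) * Matrix.diagonal v) * Uᵀ := by
          noncomm_ring
      _ = _ := by rw [h2, mul_one, Matrix.diagonal_mul_diagonal]; simp [pow_succ]

/-- A symmetric matrix whose quadratic form is bounded by `c` has spectral norm at most `c`. -/
theorem _root_.Matrix.IsSymm.norm_le_of_quadForm_le {A : Matrix d d ℝ} (hA : A.IsSymm) {c : ℝ}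
    (hc : 0 ≤ c) (h : ∀ u, |u ⬝ᵥ (A *ᵥ u)| ≤ c * (u ⬝ᵥ u)) : ‖A‖ ≤ c := by
  obtain ⟨U, v, h1, h2, hd⟩ := hA.exists_diagonalization
  rw [norm_eq_of_diagonalization h1 h2 hd]
  refine (pi_norm_le_iff_of_nonneg hc).2 fun i => ?_
  -- The test vector is the `i`-th column of `U`, a unit eigenvector, at which the form equals `v
  -- i`.
  have hUu : Uᵀ *ᵥ (U *ᵥ Pi.single i 1) = Pi.single i 1 := by
    rw [Matrix.mulVec_mulVec, h2, Matrix.one_mulVec]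
  have hn : (U *ᵥ Pi.single i 1) ⬝ᵥ (U *ᵥ Pi.single i 1) = 1 := by
    rw [Matrix.dotProduct_mulVec, ← Matrix.mulVec_transpose, hUu]; simp
  have := h (U *ᵥ Pi.single i 1)
  rw [hn, mul_one, hd, ← Matrix.mulVec_mulVec, hUu, ← Matrix.mulVec_mulVec,
    Matrix.dotProduct_mulVec, ← Matrix.mulVec_transpose, hUu] at this
  simpa using this

theorem abs_entry_le_norm (A : Matrix d d ℝ) (i j : d) : |A i j| ≤ ‖A‖ := by
  have h := dotProduct_mulVec_self_le A (Pi.single j 1)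
  have h' : A i j ^ 2 ≤ ‖A‖ ^ 2 := by
    refine le_trans ?_ (h.trans_eq (by simp))
    rw [sq, Matrix.mulVec_single_one]
    exact Finset.single_le_sum (f := fun i => A i j * A i j)
      (fun i _ => mul_self_nonneg _) (Finset.mem_univ i)
  exact abs_le_of_sq_le_sq h' (norm_nonneg _)

theorem exists_norm_apply_eq {ι : Type*} [Fintype ι] [Nonempty ι] (v : ι → ℝ) :
    ∃ i, ‖v‖ = ‖v i‖ := by
  obtain ⟨i, hi⟩ := exists_eq_ciSup_of_finite (f := fun i => ‖v i‖)
  refine ⟨i, le_antisymm ((pi_norm_le_iff_of_nonneg (norm_nonneg _)).2 fun j => ?_)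
    (norm_le_pi_norm v i)⟩
  rw [hi]
  exact le_ciSup (f := fun i => ‖v i‖) (Set.finite_range _).bddAbove j

/-- Even powers of the eigenvalues are nonnegative, so their sum dominates the largest one. -/
theorem norm_pow_le_trace {A : Matrix d d ℝ} (hA : A.IsSymm) (q : ℕ) (hq : 1 ≤ q) :
    ‖A‖ ^ (2 * q) ≤ (A ^ (2 * q)).trace := by
  obtain ⟨U, v, h1, h2, hd⟩ := hA.exists_diagonalization
  rw [norm_eq_of_diagonalization h1 h2 hd, pow_of_diagonalization h1 h2 hd, Matrix.trace_mul_comm,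
    ← mul_assoc, h2, one_mul, Matrix.trace_diagonal]
  have hnn : 0 ≤ ∑ i, v i ^ (2 * q) := Finset.sum_nonneg fun i _ => by
    rw [pow_mul]; positivity
  rcases isEmpty_or_nonempty d with hd' | hd'
  -- On an empty index type the trace is zero, and `1 ≤ q` makes the left side zero as well.
  · rw [Subsingleton.elim v 0]; simp [show q ≠ 0 by omega]
  · obtain ⟨i, hi⟩ := exists_norm_apply_eq v
    rw [hi, pow_mul, Real.norm_eq_abs, sq_abs, ← pow_mul]
    exact Finset.single_le_sum (f := fun i => v i ^ (2 * q))
      (fun i _ => by rw [pow_mul]; positivity) (Finset.mem_univ i)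

/-- In an eigenbasis of `A` the trace weights the diagonal entries of the rotated `B`, each at most
`‖B‖`, by nonnegative even powers of eigenvalues. -/
theorem trace_mul_even_pow_le (B : Matrix d d ℝ) {A : Matrix d d ℝ} (hA : A.IsSymm) (q : ℕ) :
    (B * A ^ (2 * q)).trace ≤ ‖B‖ * (A ^ (2 * q)).trace := by
  obtain ⟨U, v, h1, h2, hd⟩ := hA.exists_diagonalization
  have e : (A ^ (2 * q)).trace = ∑ i, v i ^ (2 * q) := by
    rw [pow_of_diagonalization h1 h2 hd, Matrix.trace_mul_comm,
      ← mul_assoc, h2, one_mul, Matrix.trace_diagonal]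
  have e' : (B * A ^ (2 * q)).trace = ∑ i, (Uᵀ * B * U) i i * v i ^ (2 * q) := by
    rw [pow_of_diagonalization h1 h2 hd, ← mul_assoc, Matrix.trace_mul_comm, ← mul_assoc,
      ← mul_assoc, Matrix.trace]
    simp [Matrix.mul_diagonal]
  rw [e, e', Finset.mul_sum]
  refine Finset.sum_le_sum fun i _ => mul_le_mul_of_nonneg_right ?_ (by rw [pow_mul]; positivity)
  refine (le_abs_self _).trans ((abs_entry_le_norm _ i i).trans_eq ?_)
  simpa using norm_orthogonal_conj (U := Uᵀ) (by simpa using h2) (by simpa using h1) B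

/-- Both powers are monotone on nonnegative reals, so `a ^ k - b ^ k` and `a ^ l - b ^ l` have the
same sign. -/
theorem abs_pow_mul_add_le {a b : ℝ} (ha : 0 ≤ a) (hb : 0 ≤ b) (k l : ℕ) :
    a ^ k * b ^ l + a ^ l * b ^ k ≤ a ^ (k + l) + b ^ (k + l) := by
  have : 0 ≤ (a ^ k - b ^ k) * (a ^ l - b ^ l) := by
    rcases le_total a b with h | h
    · exact mul_nonneg_of_nonpos_of_nonpos (sub_nonpos.2 (pow_le_pow_left₀ ha h k))
        (sub_nonpos.2 (pow_le_pow_left₀ ha h l))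
    · exact mul_nonneg (sub_nonneg.2 (pow_le_pow_left₀ hb h k))
        (sub_nonneg.2 (pow_le_pow_left₀ hb h l))
  rw [pow_add, pow_add]; linarith

theorem pow_mul_add_le (a b : ℝ) {k l m : ℕ} (h : k + l = 2 * m) :
    a ^ k * b ^ l + a ^ l * b ^ k ≤ a ^ (2 * m) + b ^ (2 * m) := by
  have := abs_pow_mul_add_le (abs_nonneg a) (abs_nonneg b) k l
  rw [h, pow_mul, pow_mul, sq_abs, sq_abs, ← pow_mul, ← pow_mul] at this
  refine le_trans (add_le_add ?_ ?_) this <;>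
  · rw [← abs_pow, ← abs_pow, ← abs_mul]; exact le_abs_self _

/-- The geometric mean--arithmetic mean inequality for traces. -/
theorem trace_gm_am {H W Y : Matrix d d ℝ} (hH : H.IsSymm) (hW : W.IsSymm) (hY : Y.IsSymm)
    {k l m : ℕ} (h : k + l = 2 * m) :
    (H * W ^ k * H * Y ^ l).trace + (H * W ^ l * H * Y ^ k).trace
      ≤ (H * H * W ^ (2 * m)).trace + (H * H * Y ^ (2 * m)).trace := by
  obtain ⟨U, w, hU1, hU2, hw⟩ := hW.exists_diagonalization
  obtain ⟨V, y, hV1, hV2, hy⟩ := hY.exists_diagonalization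
  -- In eigenbases of `W` and `Y` the trace is a combination of `w j ^ a * y i ^ b` with nonnegative
  -- weights independent of `a` and `b`; the scalar inequality then applies termwise.
  have e : ∀ a b, (H * W ^ a * H * Y ^ b).trace
      = ∑ i, ∑ j, (Vᵀ * H * U) i j ^ 2 * (w j ^ a * y i ^ b) := by
    intro a b
    rw [pow_of_diagonalization hU1 hU2 hw, pow_of_diagonalization hV1 hV2 hy]
    have e1 : Uᵀ * H * V = (Vᵀ * H * U)ᵀ := by
      simp [Matrix.transpose_mul, hH.eq, mul_assoc]
    have : (H * (U * Matrix.diagonal (fun i => w i ^ a) * Uᵀ) * H *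
        (V * Matrix.diagonal (fun i => y i ^ b) * Vᵀ)).trace
        = ((Vᵀ * H * U) * Matrix.diagonal (fun i => w i ^ a) * (Vᵀ * H * U)ᵀ *
          Matrix.diagonal (fun i => y i ^ b)).trace := by
      rw [← e1, ← mul_assoc (H * _ * H), Matrix.trace_mul_comm]
      simp only [mul_assoc]
    rw [this, Matrix.trace]
    simp only [Matrix.diag_apply, Matrix.mul_diagonal]
    refine Finset.sum_congr rfl fun i _ => ?_
    rw [Matrix.mul_apply, Finset.sum_mul]
    refine Finset.sum_congr rfl fun j _ => ?_
    rw [Matrix.mul_diagonal, Matrix.transpose_apply]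
    ring
  have e1 : (H * H * W ^ (2 * m)).trace = (H * W ^ (2 * m) * H * Y ^ 0).trace := by
    rw [pow_zero, mul_one, Matrix.trace_mul_comm (H * W ^ (2 * m)), ← mul_assoc]
  have e2 : (H * H * Y ^ (2 * m)).trace = (H * W ^ 0 * H * Y ^ (2 * m)).trace := by
    rw [pow_zero, mul_one]
  rw [e1, e2, e, e, e, e, ← Finset.sum_add_distrib, ← Finset.sum_add_distrib]
  refine Finset.sum_le_sum fun i _ => ?_
  rw [← Finset.sum_add_distrib, ← Finset.sum_add_distrib]
  refine Finset.sum_le_sum fun j _ => ?_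
  have := mul_le_mul_of_nonneg_left (pow_mul_add_le (w j) (y i) h) (sq_nonneg ((Vᵀ * H * U) i j))
  linarith

theorem quadForm_sum_mul_self {d ι : Type*} [Fintype d] [Fintype ι] {A : ι → Matrix d d ℝ}
    (hA : ∀ i, (A i).IsSymm) (u : d → ℝ) :
    u ⬝ᵥ ((∑ i, A i * A i) *ᵥ u) = ∑ i, (A i *ᵥ u) ⬝ᵥ (A i *ᵥ u) := by
  rw [Matrix.sum_mulVec, dotProduct_sum]
  exact Finset.sum_congr rfl fun i _ => quadForm_mul_self (hA i) u

/-- `‖∑ Aᵢ⁴‖ ≤ max ‖Aᵢ‖² ‖∑ Aᵢ²‖` for symmetric matrices. -/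
theorem norm_sum_fourth_le {ι : Type*} [Fintype ι] {A : ι → Matrix d d ℝ}
    (hA : ∀ i, (A i).IsSymm) {c : ℝ} (hc : 0 ≤ c) (h : ∀ i, ‖A i‖ ^ 2 ≤ c) :
    ‖∑ i, (A i * A i) * (A i * A i)‖ ≤ c * ‖∑ i, A i * A i‖ := by
  have hs : ∀ i, (A i * A i).IsSymm := fun i => by
    simp [Matrix.IsSymm, Matrix.transpose_mul, (hA i).eq]
  refine (sum_mul_self_isSymm hs).norm_le_of_quadForm_le (by positivity) fun u => ?_
  rw [quadForm_sum_mul_self hs, abs_of_nonneg (Finset.sum_nonneg fun i _ =>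
    Finset.sum_nonneg fun j _ => mul_self_nonneg _), mul_assoc]
  -- The form of `A i ^ 4` at `u` is the squared length of `A i` applied to `A i *ᵥ u`, at most `c`
  -- times that of `A i *ᵥ u`.
  refine le_trans ?_ (mul_le_mul_of_nonneg_left (dotProduct_mulVec_le _ u) hc)
  rw [quadForm_sum_mul_self hA, Finset.mul_sum]
  refine Finset.sum_le_sum fun i _ => ?_
  rw [← Matrix.mulVec_mulVec]
  exact (dotProduct_mulVec_self_le _ _).trans (mul_le_mul_of_nonneg_right (h i)
    (Finset.sum_nonneg fun j _ => mul_self_nonneg _))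

end SymmetricMatrix

/-! ### Noncommutative Khintchine inequality by sign flips -/

section Khintchine

variable {d ι : Type*} [Fintype d] [DecidableEq d] [Fintype ι] [DecidableEq ι]

/-- A telescoping sum, with the order of factors kept because `a` and `b` need not commute. -/
theorem sub_pow_eq_sum {R : Type*} [Ring R] (a b : R) (m : ℕ) :
    a ^ m - b ^ m = ∑ k ∈ Finset.range m, a ^ k * (a - b) * b ^ (m - 1 - k) := by
  induction m with
  | zero => simp
  | succ m ih =>
    rw [Finset.sum_range_succ]
    have : ∑ k ∈ Finset.range m, a ^ k * (a - b) * b ^ (m + 1 - 1 - k)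
        = (∑ k ∈ Finset.range m, a ^ k * (a - b) * b ^ (m - 1 - k)) * b := by
      rw [Finset.sum_mul]
      refine Finset.sum_congr rfl fun k hk => ?_
      have hk := Finset.mem_range.1 hk
      rw [show m + 1 - 1 - k = (m - 1 - k) + 1 by omega, pow_succ]
      simp only [mul_assoc]
    rw [this, ← ih]
    simp only [Nat.add_sub_cancel, Nat.sub_self, pow_zero, mul_one, pow_succ]
    noncomm_ring

/-- The trace of `A (W^{2m+1} - Y^{2m+1})` when `W - Y = 2A`. -/
theorem trace_mul_pow_sub_pow_le {A W Y : Matrix d d ℝ} (hA : A.IsSymm) (hW : W.IsSymm)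
    (hY : Y.IsSymm) (h : W - Y = (2 : ℝ) • A) (m : ℕ) :
    (A * (W ^ (2 * m + 1) - Y ^ (2 * m + 1))).trace
      ≤ (2 * m + 1) * ((A * A * W ^ (2 * m)).trace + (A * A * Y ^ (2 * m)).trace) := by
  set t : ℕ → ℝ := fun k => (A * W ^ k * A * Y ^ (2 * m - k)).trace with ht
  have e : (A * (W ^ (2 * m + 1) - Y ^ (2 * m + 1))).trace
      = 2 * ∑ k ∈ Finset.range (2 * m + 1), t k := by
    rw [sub_pow_eq_sum, h, Finset.mul_sum, Matrix.trace_sum, Finset.mul_sum]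
    refine Finset.sum_congr rfl fun k _ => ?_
    simp [ht, mul_assoc, Matrix.trace_smul]
  -- Reflecting the sum pairs the exponents `k` and `2 * m - k`, as `trace_gm_am` requires.
  have hr : ∑ k ∈ Finset.range (2 * m + 1), t (2 * m - k) = ∑ k ∈ Finset.range (2 * m + 1), t k := by
    simpa using Finset.sum_range_reflect t (2 * m + 1)
  have : 2 * ∑ k ∈ Finset.range (2 * m + 1), t k
      = ∑ k ∈ Finset.range (2 * m + 1), (t k + t (2 * m - k)) := by
    rw [Finset.sum_add_distrib, hr]; ring
  rw [e, this]
  refine (Finset.sum_le_card_nsmul _ _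
    ((A * A * W ^ (2 * m)).trace + (A * A * Y ^ (2 * m)).trace) fun k hk => ?_).trans_eq
    (by rw [Finset.card_range, nsmul_eq_mul]; push_cast; rfl)
  have hk := Finset.mem_range.1 hk
  have := trace_gm_am hA hW hY (show k + (2 * m - k) = 2 * m by omega)
  simp only [ht]
  rwa [show 2 * m - (2 * m - k) = k by omega]

/-- One step of the recursion for the even trace moments of a Rademacher series. -/
theorem sum_trace_rademacher_pow_le {A : ι → Matrix d d ℝ} (hA : ∀ i, (A i).IsSymm) (m : ℕ) :
    ∑ s : ι → ℤˣ, ((∑ i, s i • A i) ^ (2 * (m + 1))).trace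
      ≤ (2 * m + 1) * ‖∑ i, A i * A i‖ * ∑ s : ι → ℤˣ, ((∑ i, s i • A i) ^ (2 * m)).trace := by
  set S : (ι → ℤˣ) → Matrix d d ℝ := fun s => ∑ i, s i • A i with hS
  -- `fl i` flips the `i`-th sign. Being a bijection of sign patterns, it preserves sums over them.
  let fl : ι → (ι → ℤˣ) ≃ (ι → ℤˣ) := fun i => Equiv.mulLeft (Pi.mulSingle i (-1))
  have hfl : ∀ i s, fl i s i = - s i := fun i s => by simp [fl]
  have hfl' : ∀ i s, S s - S (fl i s) = (2 : ℝ) • (s i • A i) := by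
    intro i s
    simp only [hS]
    rw [← Finset.sum_sub_distrib, Finset.sum_eq_single i]
    · rw [hfl, Units.neg_smul, sub_neg_eq_add, two_smul]
    · intro j _ hj
      simp [fl, Pi.mulSingle_eq_of_ne hj]
    · simp
  have hfs : ∀ (i : ι) (f : (ι → ℤˣ) → ℝ), ∑ s, f (fl i s) = ∑ s, f s :=
    fun i f => Equiv.sum_comp (fl i) f
  have hSs : ∀ s, (S s).IsSymm := isSymm_rademacher_sum hA
  have e1 : ∀ s, (S s ^ (2 * (m + 1))).trace = ∑ i, (s i • A i * S s ^ (2 * m + 1)).trace := by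
    intro s
    rw [show 2 * (m + 1) = (2 * m + 1) + 1 by ring, pow_succ' (S s)]
    nth_rewrite 1 [hS]
    rw [Finset.sum_mul, Matrix.trace_sum]
  have sq_smul : ∀ (u : ℤˣ) (B : Matrix d d ℝ), (u • B) * (u • B) = B * B := by
    intro u B
    rcases Int.units_eq_one_or u with rfl | rfl <;> simp [Units.neg_smul]
  have key : ∀ i, ∑ s, (s i • A i * S s ^ (2 * m + 1)).trace
      ≤ (2 * m + 1) * ∑ s, (A i * A i * S s ^ (2 * m)).trace := by
    intro i
    have h2 : ∑ s, (s i • A i * S (fl i s) ^ (2 * m + 1)).trace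
        = - ∑ s, (s i • A i * S s ^ (2 * m + 1)).trace := by
      rw [← hfs i (fun s => (s i • A i * S s ^ (2 * m + 1)).trace), ← Finset.sum_neg_distrib]
      refine Finset.sum_congr rfl fun s _ => ?_
      simp [hfl, Units.neg_smul]
    -- The flip negates `s i • A i`, so averaging with the flipped sum replaces a power by half a
    -- difference of powers, to which `trace_mul_pow_sub_pow_le` applies.
    have h3 : 2 * ∑ s, (s i • A i * S s ^ (2 * m + 1)).trace
        = ∑ s, (s i • A i * (S s ^ (2 * m + 1) - S (fl i s) ^ (2 * m + 1))).trace := by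
      simp only [mul_sub, Matrix.trace_sub]
      rw [Finset.sum_sub_distrib, h2]; ring
    have h4 : ∑ s, (s i • A i * (S s ^ (2 * m + 1) - S (fl i s) ^ (2 * m + 1))).trace
        ≤ ∑ s, (2 * m + 1) * ((A i * A i * S s ^ (2 * m)).trace
          + (A i * A i * S (fl i s) ^ (2 * m)).trace) := by
      refine Finset.sum_le_sum fun s _ => ?_
      have := trace_mul_pow_sub_pow_le (isSymm_units_smul (hA i) (s i)) (hSs s) (hSs (fl i s))
        (hfl' i s) m
      rwa [sq_smul] at this
    rw [← Finset.mul_sum, Finset.sum_add_distrib,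
      hfs i (fun s => (A i * A i * S s ^ (2 * m)).trace)] at h4
    linarith
  calc ∑ s, (S s ^ (2 * (m + 1))).trace
      = ∑ i, ∑ s, (s i • A i * S s ^ (2 * m + 1)).trace := by
        rw [Finset.sum_comm]; exact Finset.sum_congr rfl fun s _ => e1 s
    _ ≤ ∑ i, (2 * m + 1) * ∑ s, (A i * A i * S s ^ (2 * m)).trace :=
        Finset.sum_le_sum fun i _ => key i
    _ = (2 * m + 1) * ∑ s, ((∑ i, A i * A i) * S s ^ (2 * m)).trace := by
        rw [← Finset.mul_sum, Finset.sum_comm]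
        simp only [Finset.sum_mul, Matrix.trace_sum]
    _ ≤ (2 * m + 1) * ∑ s, ‖∑ i, A i * A i‖ * (S s ^ (2 * m)).trace := by
        gcongr with s
        exact trace_mul_even_pow_le _ (hSs s) m
    _ = _ := by rw [← Finset.mul_sum, mul_assoc]

/-- Bernoulli's inequality gives `2 * q ^ q ≤ (q + 1) ^ q`. This lets `q ^ q` absorb the product of
the odd factors `2 * m + 1` from the recursion. -/
theorem two_mul_add_one_mul_pow_le (q : ℕ) : (2 * q + 1) * q ^ q ≤ (q + 1) ^ (q + 1) := by
  rcases Nat.eq_zero_or_pos q with rfl | hq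
  · simp
  have h : 2 * q ^ q ≤ (q + 1) ^ q := by
    have : (q : ℝ) ^ q * 2 ≤ ((q : ℝ) + 1) ^ q := by
      have hq' : (0 : ℝ) < q := by exact_mod_cast hq
      have hb := one_add_mul_le_pow (a := 1 / (q : ℝ))
        (by have : 0 ≤ 1 / (q : ℝ) := by positivity
            linarith) q
      have h2 : (1 : ℝ) + q * (1 / q) = 2 := by field_simp; norm_num
      rw [h2] at hb
      calc (q : ℝ) ^ q * 2 ≤ (q : ℝ) ^ q * (1 + 1 / q) ^ q := by gcongr
        _ = _ := by rw [← mul_pow]; congr 1; field_simp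
    rw [mul_comm]
    exact_mod_cast this
  calc (2 * q + 1) * q ^ q ≤ (q + 1) * (2 * q ^ q) := by nlinarith [Nat.zero_le (q ^ q)]
    _ ≤ (q + 1) * (q + 1) ^ q := Nat.mul_le_mul_left _ h
    _ = _ := by ring

/-- Noncommutative Khintchine inequality for even trace moments. -/
theorem sum_trace_rademacher_pow_le_pow {A : ι → Matrix d d ℝ} (hA : ∀ i, (A i).IsSymm) (q : ℕ) :
    ∑ s : ι → ℤˣ, ((∑ i, s i • A i) ^ (2 * q)).trace
      ≤ Fintype.card (ι → ℤˣ) * (q ^ q * ‖∑ i, A i * A i‖ ^ q * Fintype.card d) := by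
  induction q with
  | zero => simp
  | succ q ih =>
    have hq : ((2 * q + 1 : ℝ)) * q ^ q ≤ (q + 1) ^ (q + 1) := by
      exact_mod_cast two_mul_add_one_mul_pow_le q
    calc _ ≤ (2 * q + 1) * ‖∑ i, A i * A i‖ * ∑ s : ι → ℤˣ, ((∑ i, s i • A i) ^ (2 * q)).trace :=
          sum_trace_rademacher_pow_le hA q
      _ ≤ (2 * q + 1) * ‖∑ i, A i * A i‖ *
          (Fintype.card (ι → ℤˣ) * (q ^ q * ‖∑ i, A i * A i‖ ^ q * Fintype.card d)) := by gcongr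
      _ = ((2 * q + 1) * q ^ q) *
          (Fintype.card (ι → ℤˣ) * (‖∑ i, A i * A i‖ ^ (q + 1) * Fintype.card d)) := by ring
      _ ≤ (q + 1) ^ (q + 1) *
          (Fintype.card (ι → ℤˣ) * (‖∑ i, A i * A i‖ ^ (q + 1) * Fintype.card d)) := by gcongr
      _ = _ := by push_cast; ring

/-- The second moment of the spectral norm of a matrix Rademacher series. -/
theorem sum_norm_rademacher_sq_le {A : ι → Matrix d d ℝ} (hA : ∀ i, (A i).IsSymm)
    (hd : 3 ≤ Fintype.card d) :
    ∑ s : ι → ℤˣ, ‖∑ i, s i • A i‖ ^ 2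
      ≤ Fintype.card (ι → ℤˣ) *
        (2 * Real.exp 1 * Real.log (Fintype.card d) * ‖∑ i, A i * A i‖) := by
  set D : ℝ := (Fintype.card d : ℝ) with hD
  have hD3 : (3 : ℝ) ≤ D := by rw [hD]; exact_mod_cast hd
  -- Here `3 ≤ D` enters, through `e < 3`; it makes the rounding of `log D` cost at most a factor 2.
  have hlog : 1 ≤ Real.log D := by
    rw [Real.le_log_iff_exp_le (by linarith)]
    linarith [Real.exp_one_lt_d9]
  -- With this order, `D ≤ e ^ q`, so the `q`-th root of the dimension costs only `e`.
  set q := ⌈Real.log D⌉₊ with hq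
  have hq1 : 1 ≤ q := Nat.one_le_ceil_iff.2 (by linarith)
  have hql : (q : ℝ) ≤ 2 * Real.log D := by
    have := Nat.ceil_lt_add_one (show 0 ≤ Real.log D by linarith)
    linarith
  have hDe : D ≤ Real.exp 1 ^ q := by
    rw [← Real.exp_nat_mul, mul_one, ← Real.log_le_iff_le_exp (by linarith)]
    exact Nat.le_ceil _
  set N : ℝ := (Fintype.card (ι → ℤˣ) : ℝ) with hN
  have hN0 : 0 < N := by rw [hN]; exact_mod_cast Fintype.card_pos
  set V := ‖∑ i, A i * A i‖ with hV
  have hV0 : 0 ≤ V := norm_nonneg _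
  -- Jensen's inequality passes from the second moment to the moment of order `2 * q`.
  have hmean : (∑ s : ι → ℤˣ, N⁻¹ * ‖∑ i, s i • A i‖ ^ 2) ^ q
      ≤ ∑ s : ι → ℤˣ, N⁻¹ * (‖∑ i, s i • A i‖ ^ 2) ^ q :=
    Real.pow_arith_mean_le_arith_mean_pow _ _ _ (fun _ _ => by positivity)
      (by simp only [Finset.sum_const, Finset.card_univ, nsmul_eq_mul, ← hN]
          exact mul_inv_cancel₀ hN0.ne') (fun _ _ => by positivity) _
  have hq2 : ∑ s : ι → ℤˣ, N⁻¹ * (‖∑ i, s i • A i‖ ^ 2) ^ q ≤ (Real.exp 1 * q * V) ^ q := by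
    rw [← Finset.mul_sum, inv_mul_le_iff₀ hN0]
    calc ∑ s : ι → ℤˣ, (‖∑ i, s i • A i‖ ^ 2) ^ q
        ≤ ∑ s : ι → ℤˣ, ((∑ i, s i • A i) ^ (2 * q)).trace :=
          Finset.sum_le_sum fun s _ => by
            rw [← pow_mul]; exact norm_pow_le_trace (isSymm_rademacher_sum hA s) q hq1
      _ ≤ N * (q ^ q * V ^ q * D) := sum_trace_rademacher_pow_le_pow hA q
      _ ≤ N * (q ^ q * V ^ q * Real.exp 1 ^ q) := by gcongr
      _ = _ := by ring
  have h3 := le_of_pow_le_pow_left₀ (by omega) (by positivity) (hmean.trans hq2)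
  rw [← Finset.mul_sum, inv_mul_le_iff₀ hN0] at h3
  refine h3.trans ?_
  have : Real.exp 1 * q * V ≤ Real.exp 1 * (2 * Real.log D) * V := by gcongr
  calc N * (Real.exp 1 * q * V) ≤ N * (Real.exp 1 * (2 * Real.log D) * V) := by gcongr
    _ = _ := by ring

end Khintchine

/-! ### Symmetrization of centered i.i.d. sums -/

section Symmetrization

theorem stronglyMeasurable_signed_sum {ι E F : Type*} [Fintype ι] [MeasurableSpace E]
    [NormedAddCommGroup F] {Z : E → F}
    (hZ : StronglyMeasurable Z) (s : ι → ℤˣ) :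
    StronglyMeasurable fun y : ι → E => ∑ i, s i • Z (y i) := by
  refine Finset.stronglyMeasurable_fun_sum _ fun i _ => ?_
  have hZi := hZ.comp_measurable (measurable_pi_apply (X := fun _ : ι => E) i)
  rcases Int.units_eq_one_or (s i) with h | h
  · simpa [h] using! hZi
  · simpa [h, Units.neg_smul] using! hZi.neg

variable {ι E F : Type*} [Fintype ι] [MeasurableSpace E] [NormedAddCommGroup F] [NormedSpace ℝ F]
  (ν : Measure E) [IsProbabilityMeasure ν]

/-- Jensen's inequality for the `r`-th power of a lower integral. -/
theorem rpow_lintegral_le {α : Type*} [MeasurableSpace α] (μ : Measure α) [IsProbabilityMeasure μ]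
    {f : α → ℝ≥0∞} (hf : AEMeasurable f μ) {r : ℝ} (hr : 1 ≤ r) :
    (∫⁻ a, f a ∂μ) ^ r ≤ ∫⁻ a, f a ^ r ∂μ := by
  rcases hr.eq_or_lt with rfl | hr1
  · simp
  have h := ENNReal.lintegral_mul_le_Lp_mul_Lq μ (Real.HolderConjugate.conjExponent hr1) hf
    (aemeasurable_const (b := (1 : ℝ≥0∞)))
  simp only [Pi.mul_apply, mul_one, ENNReal.one_rpow, lintegral_one, measure_univ] at h
  refine (ENNReal.rpow_le_rpow h (by linarith)).trans_eq ?_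
  rw [← ENNReal.rpow_mul, one_div, inv_mul_cancel₀ (by linarith), ENNReal.rpow_one]

/-- Exchanging the coordinates selected by a sign vector preserves a product measure. -/
theorem measurePreserving_swapCoords (s : ι → ℤˣ) :
    MeasurePreserving (fun w : (ι → E) × (ι → E) =>
      ((fun i => if s i = 1 then w.1 i else w.2 i), (fun i => if s i = 1 then w.2 i else w.1 i)))
      ((Measure.pi fun _ : ι => ν).prod (Measure.pi fun _ : ι => ν))
      ((Measure.pi fun _ : ι => ν).prod (Measure.pi fun _ : ι => ν)) := by
  have h1 := measurePreserving_arrowProdEquivProdArrow E E ι (fun _ => ν) (fun _ => ν)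
  have h2 : MeasurePreserving (fun (v : ι → E × E) i => if s i = 1 then v i else (v i).swap)
      (Measure.pi fun _ => ν.prod ν) (Measure.pi fun _ => ν.prod ν) := by
    refine measurePreserving_pi (f := fun i (x : E × E) => if s i = 1 then x else x.swap)
      (fun _ => ν.prod ν) (fun _ => ν.prod ν) fun i => ?_
    by_cases h : s i = 1
    · simp only [h, if_true]; exact MeasurePreserving.id _
    · simpa [h] using Measure.measurePreserving_swap
  convert h1.comp (h2.comp h1.symm) using 1
  funext w
  refine Prod.ext ?_ ?_ <;> funext i <;> by_cases h : s i = 1 <;>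
    simp [MeasurableEquiv.arrowProdEquivProdArrow, Equiv.arrowProdEquivProdArrow, h]

/-- Symmetrization: centering is replaced by an arbitrary sign pattern, at the cost of a factor 2. -/
theorem lintegral_symmetrization [CompleteSpace F] {Z : E → F} (hZ : StronglyMeasurable Z)
    (hZi : Integrable Z ν) {r : ℝ} (hr : 1 ≤ r) (s : ι → ℤˣ) :
    ∫⁻ y, ‖∑ i, (Z (y i) - ∫ e, Z e ∂ν)‖ₑ ^ r ∂(Measure.pi fun _ : ι => ν)
      ≤ 2 ^ r * ∫⁻ y, ‖∑ i, s i • Z (y i)‖ₑ ^ r ∂(Measure.pi fun _ : ι => ν) := by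
  set π := Measure.pi fun _ : ι => ν with hπ
  have hr0 : 0 ≤ r := by linarith
  have hZm : ∀ i, StronglyMeasurable fun y : ι → E => Z (y i) :=
    fun i => hZ.comp_measurable (measurable_pi_apply i)
  have hZint : ∀ i, Integrable (fun y : ι → E => Z (y i)) π := fun i =>
    (measurePreserving_eval (fun _ : ι => ν) i).integrable_comp_of_integrable hZi
  have hZe : ∀ i, ∫ y, Z (y i) ∂π = ∫ e, Z e ∂ν := fun i => by
    have := (measurePreserving_eval (fun _ : ι => ν) i)
    rw [← this.map_eq, integral_map this.measurable.aemeasurable hZ.aestronglyMeasurable]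
  -- The mean is written as an integral over an independent copy `y'`, so that Jensen's inequality
  -- applies.
  have hD : ∀ y : ι → E, ∑ i, (Z (y i) - ∫ e, Z e ∂ν) = ∫ y', ∑ i, (Z (y i) - Z (y' i)) ∂π := by
    intro y
    rw [integral_finsetSum _ fun i _ => by
      simpa using! (integrable_const (Z (y i))).sub (hZint i)]
    refine Finset.sum_congr rfl fun i _ => ?_
    rw [integral_sub (integrable_const _) (hZint i), hZe]
    simp
  have hDm : StronglyMeasurable fun w : (ι → E) × (ι → E) => ∑ i, (Z (w.1 i) - Z (w.2 i)) :=
    Finset.stronglyMeasurable_fun_sum _ fun i _ =>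
      ((hZm i).comp_measurable measurable_fst).sub ((hZm i).comp_measurable measurable_snd)
  have step1 : ∫⁻ y, ‖∑ i, (Z (y i) - ∫ e, Z e ∂ν)‖ₑ ^ r ∂π
      ≤ ∫⁻ w, ‖∑ i, (Z (w.1 i) - Z (w.2 i))‖ₑ ^ r ∂(π.prod π) := by
    rw [lintegral_prod _ (hDm.enorm.pow_const r).aemeasurable]
    refine lintegral_mono fun y => ?_
    rw [hD]
    refine (ENNReal.rpow_le_rpow (enorm_integral_le_lintegral_enorm _) hr0).trans ?_
    exact rpow_lintegral_le π
      (hDm.comp_measurable measurable_prodMk_left).enorm.aemeasurable hr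
  -- Exchanging the `i`-th coordinates of the two copies wherever `s i = -1` realizes the signs
  -- without changing the law.
  have step2 : ∫⁻ w, ‖∑ i, (Z (w.1 i) - Z (w.2 i))‖ₑ ^ r ∂(π.prod π)
      = ∫⁻ w, ‖∑ i, s i • Z (w.1 i) - ∑ i, s i • Z (w.2 i)‖ₑ ^ r ∂(π.prod π) := by
    rw [← (measurePreserving_swapCoords ν s).lintegral_comp (hDm.enorm.pow_const r)]
    refine lintegral_congr fun w => ?_
    rw [← Finset.sum_sub_distrib]
    congr 2
    refine Finset.sum_congr rfl fun i _ => ?_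
    rcases Int.units_eq_one_or (s i) with h | h
    · simp [h]
    · simp [h, Units.neg_smul]; abel
  -- The two copies contribute equally, so `2 ^ (r - 1)` becomes `2 ^ r`.
  have hadd : ∀ a b : F, ‖a - b‖ₑ ^ r ≤ 2 ^ (r - 1) * (‖a‖ₑ ^ r + ‖b‖ₑ ^ r) := fun a b =>
    (ENNReal.rpow_le_rpow enorm_sub_le hr0).trans (ENNReal.rpow_add_le_mul_rpow_add_rpow _ _ hr)
  have hf1 : Measurable fun w : (ι → E) × (ι → E) => ‖∑ i, s i • Z (w.1 i)‖ₑ ^ r :=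
    ((stronglyMeasurable_signed_sum hZ s).comp_measurable measurable_fst).enorm.pow_const r
  have hf2 : Measurable fun w : (ι → E) × (ι → E) => ‖∑ i, s i • Z (w.2 i)‖ₑ ^ r :=
    ((stronglyMeasurable_signed_sum hZ s).comp_measurable measurable_snd).enorm.pow_const r
  have hf : Measurable fun y : ι → E => ‖∑ i, s i • Z (y i)‖ₑ ^ r :=
    (stronglyMeasurable_signed_sum hZ s).enorm.pow_const r
  calc _ ≤ _ := step1
    _ = _ := step2
    _ ≤ ∫⁻ w, 2 ^ (r - 1) * (‖∑ i, s i • Z (w.1 i)‖ₑ ^ r + ‖∑ i, s i • Z (w.2 i)‖ₑ ^ r)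
        ∂(π.prod π) := lintegral_mono fun w => hadd _ _
    _ = 2 ^ (r - 1) * (∫⁻ y, ‖∑ i, s i • Z (y i)‖ₑ ^ r ∂π
          + ∫⁻ y, ‖∑ i, s i • Z (y i)‖ₑ ^ r ∂π) := by
        rw [lintegral_const_mul _ (by fun_prop), lintegral_add_left hf1,
          measurePreserving_fst.lintegral_comp hf, measurePreserving_snd.lintegral_comp hf]
    _ = _ := by
        rw [← two_mul, ← mul_assoc]
        congr 1
        conv_lhs => rw [← ENNReal.rpow_one 2, ← ENNReal.rpow_mul]
        rw [← ENNReal.rpow_add _ _ (by norm_num) (by norm_num)]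
        norm_num

end Symmetrization

/-! ### Matrix Rosenthal inequality -/

section MatrixRosenthal

/-- Symmetrization holds for every sign pattern `s`, hence on average over `s`, where Khintchine
applies pointwise. -/
theorem le_of_forall_le_of_sum_le {α S : Type*} [MeasurableSpace α] (μ : Measure α) [Fintype S]
    [Nonempty S] {T : ℝ≥0∞} {k : ℝ≥0∞} {f : S → α → ℝ≥0∞} {g : α → ℝ≥0∞}
    (hf : ∀ s, Measurable (f s)) (hT : ∀ s, T ≤ k * ∫⁻ a, f s a ∂μ)
    (hfg : ∀ a, ∑ s, f s a ≤ Fintype.card S * g a) : T ≤ k * ∫⁻ a, g a ∂μ := by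
  have hN : (Fintype.card S : ℝ≥0∞) ≠ 0 := by simp
  have hN' : (Fintype.card S : ℝ≥0∞) ≠ ⊤ := ENNReal.natCast_ne_top _
  rw [← ENNReal.mul_le_mul_iff_right hN hN']
  calc (Fintype.card S : ℝ≥0∞) * T = ∑ _s : S, T := by simp
    _ ≤ ∑ s, k * ∫⁻ a, f s a ∂μ := Finset.sum_le_sum fun s _ => hT s
    _ = k * ∫⁻ a, ∑ s, f s a ∂μ := by
        rw [← Finset.mul_sum, lintegral_finsetSum _ fun s _ => hf s]
    _ ≤ k * ∫⁻ a, Fintype.card S * g a ∂μ := by gcongr with a; exact hfg a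
    _ = _ := by rw [lintegral_const_mul' _ _ hN']; ring

variable {d ι E : Type*} [Fintype d] [DecidableEq d] [Fintype ι] [DecidableEq ι]

theorem sum_enorm_rademacher_sq_le {A : ι → Matrix d d ℝ} (hA : ∀ i, (A i).IsSymm)
    (hd : 3 ≤ Fintype.card d) :
    ∑ s : ι → ℤˣ, ‖∑ i, s i • A i‖ₑ ^ (2 : ℝ)
      ≤ Fintype.card (ι → ℤˣ) *
        (ENNReal.ofReal (2 * Real.exp 1 * Real.log (Fintype.card d)) * ‖∑ i, A i * A i‖ₑ) := by
  have hlog : 0 ≤ Real.log (Fintype.card d) := Real.log_natCast_nonneg _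
  have h := ENNReal.ofReal_le_ofReal (sum_norm_rademacher_sq_le hA hd)
  rw [ENNReal.ofReal_sum_of_nonneg fun _ _ => by positivity, ENNReal.ofReal_mul (by positivity),
    ENNReal.ofReal_mul (by positivity), ENNReal.ofReal_natCast, ofReal_norm] at h
  simpa [ENNReal.ofReal_pow, ofReal_norm] using h

theorem sum_enorm_rademacher_le {A : ι → Matrix d d ℝ} (hA : ∀ i, (A i).IsSymm)
    (hd : 3 ≤ Fintype.card d) :
    ∑ s : ι → ℤˣ, ‖∑ i, s i • A i‖ₑ
      ≤ Fintype.card (ι → ℤˣ) *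
        (ENNReal.ofReal (2 * Real.exp 1 * Real.log (Fintype.card d)) * ‖∑ i, A i * A i‖ₑ)
          ^ (1 / 2 : ℝ) := by
  have h := sum_enorm_rademacher_sq_le hA hd
  have hcs := ENNReal.inner_le_Lp_mul_Lq Finset.univ (fun s : ι → ℤˣ => ‖∑ i, s i • A i‖ₑ)
    (fun _ => 1) Real.HolderConjugate.two_two
  simp only [mul_one, ENNReal.one_rpow, Finset.sum_const, Finset.card_univ, nsmul_eq_mul] at hcs
  refine hcs.trans ((mul_le_mul_left (ENNReal.rpow_le_rpow h (by norm_num)) _).trans_eq ?_)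
  rw [ENNReal.mul_rpow_of_nonneg _ _ (by norm_num), mul_right_comm,
    ← ENNReal.rpow_add_of_nonneg _ _ (by norm_num) (by norm_num)]
  norm_num

/-- With `x`, `y` the roots of `I`, `a`: if `x > y + b`, then `x ^ 2 > x * y + b * x ≥ y ^ 2 + b *
x`, a contradiction. -/
theorem sqrt_le_add_of_le_add_mul_sqrt {I a b : ℝ≥0∞} (hI : I ≠ ⊤)
    (h : I ≤ a + b * I ^ (1 / 2 : ℝ)) : I ^ (1 / 2 : ℝ) ≤ a ^ (1 / 2 : ℝ) + b := by
  have hsq : ∀ t : ℝ≥0∞, t = (t ^ (1 / 2 : ℝ)) ^ 2 := fun t => by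
    rw [← ENNReal.rpow_natCast, ← ENNReal.rpow_mul]; norm_num
  rw [hsq a] at h
  nth_rewrite 1 [hsq I] at h
  have hI' : I ^ (1 / 2 : ℝ) ≠ ⊤ := ENNReal.rpow_ne_top_of_nonneg (by norm_num) hI
  generalize I ^ (1 / 2 : ℝ) = x at *
  generalize a ^ (1 / 2 : ℝ) = y at *
  by_cases hy : y = ⊤
  · simp [hy]
  by_cases hb : b = ⊤
  · simp [hb]
  lift x to NNReal using hI'
  lift y to NNReal using hy
  lift b to NNReal using hb
  norm_cast at h ⊢
  rw [← NNReal.coe_le_coe] at h ⊢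
  push_cast at h ⊢
  have hx := x.2; have hy := y.2; have hb := b.2
  by_contra! hlt
  nlinarith [mul_nonneg hy hb]

variable [MeasurableSpace E] (ν : Measure E) [IsProbabilityMeasure ν]

/-- A matrix Rosenthal inequality for the second moment of the spectral norm of a sum of centered
i.i.d. symmetric random matrices. -/
theorem matrix_rosenthal {Z : E → Matrix d d ℝ} (hZ : StronglyMeasurable Z)
    (hs : ∀ y, (Z y).IsSymm) (hi : Integrable Z ν) (h2 : ∫⁻ y, ‖Z y‖ₑ ^ 2 ∂ν ≠ ⊤)
    (hd : 3 ≤ Fintype.card d) :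
    (∫⁻ y, ‖∑ i, (Z (y i) - ∫ e, Z e ∂ν)‖ₑ ^ (2 : ℝ) ∂(Measure.pi fun _ : ι => ν)) ^ (1 / 2 : ℝ)
      ≤ (4 * ENNReal.ofReal (2 * Real.exp 1 * Real.log (Fintype.card d))) ^ (1 / 2 : ℝ)
          * (Fintype.card ι * ‖∫ e, Z e * Z e ∂ν‖ₑ) ^ (1 / 2 : ℝ)
        + 4 * ENNReal.ofReal (2 * Real.exp 1 * Real.log (Fintype.card d))
          * (∫⁻ y, ⨆ i, ‖Z (y i)‖ₑ ^ 2 ∂(Measure.pi fun _ : ι => ν)) ^ (1 / 2 : ℝ) := by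
  set π := Measure.pi fun _ : ι => ν with hπ
  set c := ENNReal.ofReal (2 * Real.exp 1 * Real.log (Fintype.card d)) with hc
  set I := ∫⁻ y, ‖∑ i, Z (y i) * Z (y i)‖ₑ ∂π with hI
  set G := ∫⁻ y, ⨆ i, ‖Z (y i)‖ₑ ^ 2 ∂π with hG
  have hZ2 : StronglyMeasurable fun y => Z y * Z y := hZ.mul hZ
  have hs2 : ∀ y, (Z y * Z y).IsSymm := fun y => by
    simp [Matrix.IsSymm, Matrix.transpose_mul, (hs y).eq]
  have hnn : ∀ y, ‖Z y * Z y‖ₑ ≤ ‖Z y‖ₑ ^ 2 := fun y => by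
    have := norm_mul_le (Z y) (Z y)
    rw [← ofReal_norm, ← ofReal_norm, ← ENNReal.ofReal_pow (norm_nonneg _), sq]
    exact ENNReal.ofReal_le_ofReal this
  have hi2 : Integrable (fun y => Z y * Z y) ν :=
    ⟨hZ2.aestronglyMeasurable, (lintegral_mono hnn).trans_lt h2.lt_top⟩
  have hZi : ∀ i, Measurable fun y : ι → E => ‖Z (y i)‖ₑ := fun i =>
    (hZ.comp_measurable (measurable_pi_apply (X := fun _ : ι => E) i)).enorm
  have hSm : StronglyMeasurable fun y : ι → E => ∑ i, Z (y i) * Z (y i) := by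
    simpa using stronglyMeasurable_signed_sum (ι := ι) hZ2 1
  have hT : ∫⁻ y, ‖∑ i, (Z (y i) - ∫ e, Z e ∂ν)‖ₑ ^ (2 : ℝ) ∂π ≤ 4 * c * I := by
    have := le_of_forall_le_of_sum_le π
      (f := fun (s : ι → ℤˣ) y => ‖∑ i, s i • Z (y i)‖ₑ ^ (2 : ℝ))
      (fun s => (stronglyMeasurable_signed_sum hZ s).enorm.pow_const _)
      (fun s => lintegral_symmetrization ν hZ hi (r := 2) (by norm_num) s)
      (fun y => sum_enorm_rademacher_sq_le (fun i => hs (y i)) hd)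
    refine this.trans_eq ?_
    rw [lintegral_const_mul _ hSm.enorm, ← mul_assoc]
    norm_num [hc, hI]
  -- Second symmetrization, now of the squares and with `r = 1`.
  have hJ : ∫⁻ y, ‖∑ i, (Z (y i) * Z (y i) - ∫ e, Z e * Z e ∂ν)‖ₑ ∂π
      ≤ 2 * ∫⁻ y, (c * ‖∑ i, (Z (y i) * Z (y i)) * (Z (y i) * Z (y i))‖ₑ) ^ (1 / 2 : ℝ) ∂π := by
    refine le_of_forall_le_of_sum_le π
      (f := fun (s : ι → ℤˣ) y => ‖∑ i, s i • (Z (y i) * Z (y i))‖ₑ)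
      (fun s => (stronglyMeasurable_signed_sum hZ2 s).enorm)
      (fun s => ?_)
      (fun y => sum_enorm_rademacher_le (fun i => hs2 (y i)) hd)
    simpa using lintegral_symmetrization ν hZ2 hi2 (r := 1) le_rfl s
  have hpt : ∀ y : ι → E, (c * ‖∑ i, (Z (y i) * Z (y i)) * (Z (y i) * Z (y i))‖ₑ) ^ (1 / 2 : ℝ)
      ≤ c ^ (1 / 2 : ℝ) * ((⨆ i, ‖Z (y i)‖ₑ ^ 2) ^ (1 / 2 : ℝ)
        * ‖∑ i, Z (y i) * Z (y i)‖ₑ ^ (1 / 2 : ℝ)) := by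
    intro y
    rw [← ENNReal.mul_rpow_of_nonneg _ _ (by norm_num),
      ← ENNReal.mul_rpow_of_nonneg _ _ (by norm_num)]
    refine ENNReal.rpow_le_rpow ?_ (by norm_num)
    gcongr
    have hfin : (⨆ i, ‖Z (y i)‖ₑ ^ 2) ≠ ⊤ := by
      refine ne_top_of_le_ne_top (b := ∑ i, ‖Z (y i)‖ₑ ^ 2) ?_ (iSup_le fun i =>
        Finset.single_le_sum (f := fun i => ‖Z (y i)‖ₑ ^ 2) (fun _ _ => zero_le)
          (Finset.mem_univ i))
      exact ENNReal.sum_ne_top.2 fun i _ => by simp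
    have := norm_sum_fourth_le (A := fun i => Z (y i)) (fun i => hs (y i))
      (c := (⨆ i, ‖Z (y i)‖ₑ ^ 2).toReal) ENNReal.toReal_nonneg fun i => by
        have := ENNReal.toReal_mono hfin (le_iSup (fun i => ‖Z (y i)‖ₑ ^ 2) i)
        simpa using this
    have := ENNReal.ofReal_le_ofReal this
    rwa [ENNReal.ofReal_mul ENNReal.toReal_nonneg, ENNReal.ofReal_toReal hfin, ofReal_norm,
      ofReal_norm] at this
  have hGm : Measurable fun y : ι → E => ⨆ i, ‖Z (y i)‖ₑ ^ 2 :=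
    Measurable.iSup fun i => (hZi i).pow_const 2
  have hJ2 : ∫⁻ y, ‖∑ i, (Z (y i) * Z (y i) - ∫ e, Z e * Z e ∂ν)‖ₑ ∂π
      ≤ 2 * c ^ (1 / 2 : ℝ) * G ^ (1 / 2 : ℝ) * I ^ (1 / 2 : ℝ) := by
    refine hJ.trans ?_
    have hcs := ENNReal.lintegral_mul_le_Lp_mul_Lq π Real.HolderConjugate.two_two
      (hGm.pow_const (1 / 2 : ℝ)).aemeasurable (hSm.enorm.pow_const (1 / 2 : ℝ)).aemeasurable
    simp only [Pi.mul_apply, ← ENNReal.rpow_mul] at hcs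
    norm_num at hcs
    calc _ ≤ 2 * ∫⁻ y, c ^ (1 / 2 : ℝ) * ((⨆ i, ‖Z (y i)‖ₑ ^ 2) ^ (1 / 2 : ℝ)
        * ‖∑ i, Z (y i) * Z (y i)‖ₑ ^ (1 / 2 : ℝ)) ∂π := by gcongr with y; exact hpt y
      _ = 2 * (c ^ (1 / 2 : ℝ) * ∫⁻ y, ((⨆ i, ‖Z (y i)‖ₑ ^ 2) ^ (1 / 2 : ℝ)
        * ‖∑ i, Z (y i) * Z (y i)‖ₑ ^ (1 / 2 : ℝ)) ∂π) := by
          rw [lintegral_const_mul' _ _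
            (ENNReal.rpow_ne_top_of_nonneg (by norm_num) ENNReal.ofReal_ne_top)]
      _ ≤ 2 * (c ^ (1 / 2 : ℝ) * (G ^ (1 / 2 : ℝ) * I ^ (1 / 2 : ℝ))) := by
          gcongr
      _ = _ := by ring
  have hIle : I ≤ Fintype.card ι * ‖∫ e, Z e * Z e ∂ν‖ₑ
      + 2 * c ^ (1 / 2 : ℝ) * G ^ (1 / 2 : ℝ) * I ^ (1 / 2 : ℝ) := by
    refine le_trans ?_ (add_le_add le_rfl hJ2)
    have hk : ∀ y : ι → E, ‖∑ i, Z (y i) * Z (y i)‖ₑ ≤ Fintype.card ι * ‖∫ e, Z e * Z e ∂ν‖ₑ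
        + ‖∑ i, (Z (y i) * Z (y i) - ∫ e, Z e * Z e ∂ν)‖ₑ := by
      intro y
      have : ∑ i, Z (y i) * Z (y i) = ∑ _i : ι, ∫ e, Z e * Z e ∂ν
          + ∑ i, (Z (y i) * Z (y i) - ∫ e, Z e * Z e ∂ν) := by
        rw [← Finset.sum_add_distrib]; simp
      rw [this]
      refine (enorm_add_le _ _).trans (add_le_add ?_ le_rfl)
      refine (enorm_sum_le _ _).trans_eq ?_
      simp
    refine (lintegral_mono hk).trans_eq ?_
    rw [lintegral_add_left measurable_const]
    simp
  -- Finiteness is needed to solve `I ≤ a + b * √I` for `√I`.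
  have hIfin : I ≠ ⊤ := by
    have h : I ≤ ∑ _i : ι, ∫⁻ e, ‖Z e‖ₑ ^ 2 ∂ν := by
      calc I ≤ ∫⁻ y, ∑ i, ‖Z (y i)‖ₑ ^ 2 ∂π := lintegral_mono fun y =>
            (enorm_sum_le _ _).trans (Finset.sum_le_sum fun i _ => hnn _)
        _ = ∑ i, ∫⁻ y, ‖Z (y i)‖ₑ ^ 2 ∂π :=
            lintegral_finsetSum _ fun i _ => (hZi i).pow_const 2
        _ = _ := Finset.sum_congr rfl fun i _ =>
            (measurePreserving_eval (fun _ : ι => ν) i).lintegral_comp (hZ.enorm.pow_const 2)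
    exact ne_top_of_le_ne_top (ENNReal.sum_ne_top.2 fun _ _ => h2) h
  have hIs := sqrt_le_add_of_le_add_mul_sqrt hIfin hIle
  calc _ ≤ (4 * c * I) ^ (1 / 2 : ℝ) := ENNReal.rpow_le_rpow hT (by norm_num)
    _ = (4 * c) ^ (1 / 2 : ℝ) * I ^ (1 / 2 : ℝ) := ENNReal.mul_rpow_of_nonneg _ _ (by norm_num)
    _ ≤ (4 * c) ^ (1 / 2 : ℝ) * ((Fintype.card ι * ‖∫ e, Z e * Z e ∂ν‖ₑ) ^ (1 / 2 : ℝ)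
        + 2 * c ^ (1 / 2 : ℝ) * G ^ (1 / 2 : ℝ)) := by gcongr
    _ = _ := by
        rw [mul_add, ← mul_assoc, ← mul_assoc]
        congr 2
        have h4 : (4 : ℝ≥0∞) ^ (1 / 2 : ℝ) = 2 := by
          rw [show (4 : ℝ≥0∞) = 2 ^ (2 : ℝ) by norm_num, ← ENNReal.rpow_mul]; norm_num
        have hcc : c ^ (1 / 2 : ℝ) * c ^ (1 / 2 : ℝ) = c := by
          rw [← ENNReal.rpow_add_of_nonneg _ _ (by norm_num) (by norm_num)]; norm_num
        rw [ENNReal.mul_rpow_of_nonneg _ _ (by norm_num), h4]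
        calc 2 * c ^ (1 / 2 : ℝ) * 2 * c ^ (1 / 2 : ℝ)
            = 2 * 2 * (c ^ (1 / 2 : ℝ) * c ^ (1 / 2 : ℝ)) := by ring
          _ = 4 * c := by rw [hcc]; norm_num

end MatrixRosenthal

/-! ### Masked rank-one matrices: norm and matrix variance -/

section MaskedRankOne

variable {p : ℕ}

/-- The masked rank-one matrix `M ⊙ y yᵀ`. -/
noncomputable def maskedRankOne (M : Matrix (Fin p) (Fin p) ℝ) (y : Fin p → ℝ) :
    Matrix (Fin p) (Fin p) ℝ :=
  M ⊙ Matrix.vecMulVec y y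

theorem maskedRankOne_isSymm {M : Matrix (Fin p) (Fin p) ℝ} (hM : M.IsSymm) (y : Fin p → ℝ) :
    (maskedRankOne M y).IsSymm := by
  ext i j
  simp [maskedRankOne, Matrix.vecMulVec_apply, hM.apply i j, mul_comm (y i)]

theorem continuous_maskedRankOne (M : Matrix (Fin p) (Fin p) ℝ) :
    Continuous (maskedRankOne M) := by
  refine continuous_matrix fun i j => ?_
  simp only [maskedRankOne, Matrix.hadamard_apply, Matrix.vecMulVec_apply]
  fun_prop

/-- This factorization yields the norm bound, since a diagonal matrix has the maximum norm of its
entries. -/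
theorem maskedRankOne_eq_diagonal_mul (M : Matrix (Fin p) (Fin p) ℝ) (y : Fin p → ℝ) :
    maskedRankOne M y = Matrix.diagonal y * M * Matrix.diagonal y := by
  ext i j
  simp [maskedRankOne, Matrix.vecMulVec_apply, Matrix.mul_diagonal, Matrix.diagonal_mul]
  ring

theorem norm_maskedRankOne_le (M : Matrix (Fin p) (Fin p) ℝ) (y : Fin p → ℝ) :
    ‖maskedRankOne M y‖ ≤ ‖M‖ * ‖y‖ ^ 2 := by
  rw [maskedRankOne_eq_diagonal_mul]
  refine (norm_mul_le _ _).trans ((mul_le_mul_of_nonneg_right (norm_mul_le _ _)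
    (norm_nonneg _)).trans_eq ?_)
  rw [Matrix.l2_opNorm_diagonal]
  ring

theorem enorm_maskedRankOne_le (M : Matrix (Fin p) (Fin p) ℝ) (y : Fin p → ℝ) :
    ‖maskedRankOne M y‖ₑ ≤ ‖M‖ₑ * ‖y‖ₑ ^ 2 := by
  have := ENNReal.ofReal_le_ofReal (norm_maskedRankOne_le M y)
  rwa [ENNReal.ofReal_mul (norm_nonneg _), ENNReal.ofReal_pow (norm_nonneg _), ofReal_norm,
    ofReal_norm, ofReal_norm] at this

theorem sum_sq_le_normOneTwo_sq (M : Matrix (Fin p) (Fin p) ℝ) (j : Fin p) :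
    ∑ i, M i j ^ 2 ≤ normOneTwo M ^ 2 := by
  have h0 : 0 ≤ ∑ i, M i j ^ 2 := Finset.sum_nonneg fun _ _ => sq_nonneg _
  have : Real.sqrt (∑ i, M i j ^ 2) ≤ normOneTwo M :=
    le_ciSup (f := fun j => Real.sqrt (∑ i, M i j ^ 2)) (Set.finite_range _).bddAbove j
  calc _ = Real.sqrt (∑ i, M i j ^ 2) ^ 2 := (Real.sq_sqrt h0).symm
    _ ≤ _ := pow_le_pow_left₀ (Real.sqrt_nonneg _) this 2

theorem normOneTwo_nonneg (M : Matrix (Fin p) (Fin p) ℝ) : 0 ≤ normOneTwo M :=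
  Real.iSup_nonneg fun _ => Real.sqrt_nonneg _

theorem integral_linearMap {d α : Type*} [Fintype d] [DecidableEq d] [MeasurableSpace α]
    {μ : Measure α} {f : α → Matrix d d ℝ} (hf : Integrable f μ) (φ : Matrix d d ℝ →ₗ[ℝ] ℝ) :
    φ (∫ a, f a ∂μ) = ∫ a, φ (f a) ∂μ :=
  ((LinearMap.toContinuousLinearMap φ).integral_comp_comm hf).symm

theorem integral_matrix_apply {d α : Type*} [Fintype d] [DecidableEq d] [MeasurableSpace α]
    {μ : Measure α} {f : α → Matrix d d ℝ} (hf : Integrable f μ) (i j : d) :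
    (∫ a, f a ∂μ) i j = ∫ a, f a i j ∂μ :=
  integral_linearMap hf (Matrix.entryLinearMap ℝ ℝ i j)

theorem quadForm_integral {d α : Type*} [Fintype d] [DecidableEq d] [MeasurableSpace α]
    {μ : Measure α} {f : α → Matrix d d ℝ} (hf : Integrable f μ) (u : d → ℝ) :
    u ⬝ᵥ ((∫ a, f a ∂μ) *ᵥ u) = ∫ a, u ⬝ᵥ (f a *ᵥ u) ∂μ :=
  integral_linearMap hf
    { toFun := fun A => u ⬝ᵥ (A *ᵥ u)
      map_add' := fun A B => by rw [Matrix.add_mulVec, dotProduct_add]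
      map_smul' := fun c A => by rw [Matrix.smul_mulVec, dotProduct_smul]; rfl }

variable (ν : Measure (Fin p → ℝ))

theorem lintegral_sq_mul_sq_le {α : Type*} [MeasurableSpace α] {μ : Measure α} {f g : α → ℝ≥0∞}
    (hf : AEMeasurable f μ) (hg : AEMeasurable g μ) :
    ∫⁻ a, f a ^ 2 * g a ^ 2 ∂μ
      ≤ (∫⁻ a, f a ^ 4 ∂μ) ^ (1 / 2 : ℝ) * (∫⁻ a, g a ^ 4 ∂μ) ^ (1 / 2 : ℝ) := by
  have h := ENNReal.lintegral_mul_le_Lp_mul_Lq μ Real.HolderConjugate.two_two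
    (hf.pow_const 2) (hg.pow_const 2)
  simpa [← pow_mul] using h

/-- The quadratic form at `u` is the integral of ∑_i y_i² (∑_j M_ij u_j y_j)². Cauchy–Schwarz bounds
the `i`-th term by D² H² ∑_j (M_ij u_j)². -/
theorem norm_integral_maskedRankOne_sq_le {M : Matrix (Fin p) (Fin p) ℝ} (hM : M.IsSymm)
    (hi : Integrable (fun y => maskedRankOne M y * maskedRankOne M y) ν) {D H : NNReal}
    (hD : ∀ j, ∫⁻ y, ‖y j‖ₑ ^ 4 ∂ν ≤ (D : ℝ≥0∞) ^ 4)
    (hH : ∀ u : Fin p → ℝ, ∫⁻ y, ‖∑ j, u j * y j‖ₑ ^ 4 ∂ν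
      ≤ (H : ℝ≥0∞) ^ 4 * ENNReal.ofReal (∑ j, u j ^ 2) ^ 2) :
    ‖∫ y, maskedRankOne M y * maskedRankOne M y ∂ν‖ ≤ (normOneTwo M * (D * H)) ^ 2 := by
  have hs : ∀ y, (maskedRankOne M y * maskedRankOne M y).IsSymm := fun y => by
    simp [Matrix.IsSymm, Matrix.transpose_mul, (maskedRankOne_isSymm hM y).eq]
  have hsymm : (∫ y, maskedRankOne M y * maskedRankOne M y ∂ν).IsSymm := by
    ext i j
    rw [Matrix.transpose_apply, integral_matrix_apply hi, integral_matrix_apply hi]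
    exact integral_congr_ae (ae_of_all _ fun y => (hs y).apply i j)
  refine hsymm.norm_le_of_quadForm_le (by positivity) fun u => ?_
  have hsqrt4 : ∀ t : ℝ≥0∞, (t ^ 4) ^ (1 / 2 : ℝ) = t ^ 2 := fun t => by
    rw [← ENNReal.rpow_natCast, ← ENNReal.rpow_natCast, ← ENNReal.rpow_mul]; norm_num
  have hsqrt2 : ∀ t : ℝ≥0∞, (t ^ 2) ^ (1 / 2 : ℝ) = t := fun t => by
    rw [← ENNReal.rpow_natCast, ← ENNReal.rpow_mul]; norm_num
  have hrow : ∀ y i, (maskedRankOne M y *ᵥ u) i = y i * ∑ j, M i j * u j * y j := fun y i => by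
    simp only [Matrix.mulVec, dotProduct, maskedRankOne, Matrix.hadamard_apply,
      Matrix.vecMulVec_apply, Finset.mul_sum]
    exact Finset.sum_congr rfl fun j _ => by ring
  have hnn : ∀ y, 0 ≤ (maskedRankOne M y *ᵥ u) ⬝ᵥ (maskedRankOne M y *ᵥ u) := fun y =>
    Finset.sum_nonneg fun _ _ => mul_self_nonneg _
  rw [quadForm_integral hi]
  simp only [quadForm_mul_self (maskedRankOne_isSymm hM _)]
  rw [abs_of_nonneg (integral_nonneg hnn)]
  have hu0 : 0 ≤ u ⬝ᵥ u := Finset.sum_nonneg fun _ _ => mul_self_nonneg _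
  have hrow2 : ∀ y, ENNReal.ofReal ((maskedRankOne M y *ᵥ u) ⬝ᵥ (maskedRankOne M y *ᵥ u))
      = ∑ i, ‖y i‖ₑ ^ 2 * ‖∑ j, M i j * u j * y j‖ₑ ^ 2 := fun y => by
    rw [dotProduct, ENNReal.ofReal_sum_of_nonneg fun _ _ => mul_self_nonneg _]
    refine Finset.sum_congr rfl fun i _ => ?_
    rw [hrow, ← sq, ← mul_pow, ← enorm_mul, ← sq_abs, ENNReal.ofReal_pow (abs_nonneg _),
      ← Real.enorm_eq_ofReal_abs]
  have hlin : ∀ i, Measurable fun y : Fin p → ℝ => ‖∑ j, M i j * u j * y j‖ₑ := fun i => by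
    fun_prop
  have key : ∫⁻ y, ENNReal.ofReal ((maskedRankOne M y *ᵥ u) ⬝ᵥ (maskedRankOne M y *ᵥ u)) ∂ν
      ≤ ENNReal.ofReal ((normOneTwo M * (D * H)) ^ 2 * (u ⬝ᵥ u)) := by
    simp only [hrow2]
    rw [lintegral_finsetSum _ fun i _ => by have := hlin i; fun_prop]
    calc ∑ i, ∫⁻ y, ‖y i‖ₑ ^ 2 * ‖∑ j, M i j * u j * y j‖ₑ ^ 2 ∂ν
        ≤ ∑ i, (D : ℝ≥0∞) ^ 2 * ((H : ℝ≥0∞) ^ 2 * ENNReal.ofReal (∑ j, (M i j * u j) ^ 2)) := by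
          refine Finset.sum_le_sum fun i _ => ?_
          refine (lintegral_sq_mul_sq_le (measurable_pi_apply i).enorm.aemeasurable
            (hlin i).aemeasurable).trans ?_
          refine mul_le_mul' ?_ ?_
          · rw [← hsqrt4]; exact ENNReal.rpow_le_rpow (hD i) (by norm_num)
          · refine (ENNReal.rpow_le_rpow (hH fun j => M i j * u j) (by norm_num)).trans_eq ?_
            rw [ENNReal.mul_rpow_of_nonneg _ _ (by norm_num), hsqrt4, hsqrt2]
      _ = ENNReal.ofReal ((D * H : ℝ) ^ 2 * ∑ i, ∑ j, (M i j * u j) ^ 2) := by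
          rw [← Finset.mul_sum, ← Finset.mul_sum, ← ENNReal.ofReal_sum_of_nonneg
            fun _ _ => Finset.sum_nonneg fun _ _ => sq_nonneg _, mul_pow,
            ENNReal.ofReal_mul (by positivity), ENNReal.ofReal_mul (by positivity),
            ENNReal.ofReal_pow D.coe_nonneg, ENNReal.ofReal_pow H.coe_nonneg,
            ENNReal.ofReal_coe_nnreal, ENNReal.ofReal_coe_nnreal, mul_assoc]
      _ ≤ _ := by
          refine ENNReal.ofReal_le_ofReal ?_
          -- Summing over `i` first produces the squared column norms of `M`.
          rw [Finset.sum_comm, mul_pow (normOneTwo M), mul_comm (normOneTwo M ^ 2), mul_assoc]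
          refine mul_le_mul_of_nonneg_left ?_ (by positivity)
          rw [dotProduct, Finset.mul_sum]
          refine Finset.sum_le_sum fun j _ => ?_
          simp only [mul_pow]
          rw [← Finset.sum_mul, ← sq]
          exact mul_le_mul_of_nonneg_right (sum_sq_le_normOneTwo_sq M j) (sq_nonneg _)
  rw [integral_eq_lintegral_of_nonneg_ae (ae_of_all _ hnn)]
  · exact ENNReal.toReal_le_of_le_ofReal (by positivity) key
  · refine Continuous.aestronglyMeasurable ?_
    have := continuous_maskedRankOne M
    exact (this.matrix_mulVec continuous_const).dotProduct (this.matrix_mulVec continuous_const)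

end MaskedRankOne

/-! ### Moment parameters and the maximal fourth moment -/

section Moments

variable {p n : ℕ} {Ω Ω' : Type*} [MeasurableSpace Ω] [MeasurableSpace Ω']

theorem exists_enorm_apply_eq {ι : Type*} [Fintype ι] [Nonempty ι] (v : ι → ℝ) :
    ∃ i, ‖v‖ₑ = ‖v i‖ₑ := by
  obtain ⟨i, hi⟩ := exists_norm_apply_eq v
  exact ⟨i, by rw [← ofReal_norm, hi, ofReal_norm]⟩

theorem lintegral_rpow_le_diagMoment {x : Ω → Fin p → ℝ} {P : Measure Ω} {r : ℝ} (hr : 0 < r)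
    (j : Fin p) : ∫⁻ ω, ‖x ω j‖ₑ ^ r ∂P ≤ diagMoment x P r ^ r := by
  have h : (∫⁻ ω, ‖x ω j‖ₑ ^ r ∂P) ^ (1 / r) ≤ diagMoment x P r :=
    le_iSup (fun j => (∫⁻ ω, ‖x ω j‖ₑ ^ r ∂P) ^ (1 / r)) j
  have := ENNReal.rpow_le_rpow h hr.le
  rwa [← ENNReal.rpow_mul, one_div, inv_mul_cancel₀ hr.ne', ENNReal.rpow_one] at this

theorem eLpNorm_four_eq {P : Measure Ω} (f : Ω → ℝ) :
    eLpNorm f 4 P = (∫⁻ ω, ‖f ω‖ₑ ^ (4 : ℝ) ∂P) ^ (1 / 4 : ℝ) := by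
  rw [eLpNorm_eq_lintegral_rpow_enorm_toReal (by norm_num) (by norm_num)]
  norm_num

theorem diagMoment_four_ne_top {x : Ω → Fin p → ℝ} {P : Measure Ω}
    (hx4 : ∀ j, MemLp (fun ω => x ω j) 4 P) : diagMoment x P 4 ≠ ⊤ := by
  refine ne_top_of_le_ne_top (b := ∑ j, eLpNorm (fun ω => x ω j) 4 P)
    (ENNReal.sum_ne_top.2 fun j _ => (hx4 j).2.ne) (iSup_le fun j => ?_)
  rw [← eLpNorm_four_eq fun ω => x ω j]
  exact Finset.single_le_sum (f := fun j => eLpNorm (fun ω => x ω j) 4 P) (fun _ _ => zero_le)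
    (Finset.mem_univ j)

/-- Minkowski's inequality, since every coordinate of a unit vector is at most 1 in absolute value.
-/
theorem unifFourthMoment_ne_top {x : Ω → Fin p → ℝ} {P : Measure Ω}
    (hx4 : ∀ j, MemLp (fun ω => x ω j) 4 P) : unifFourthMoment x P ≠ ⊤ := by
  refine ne_top_of_le_ne_top (b := ∑ j, eLpNorm (fun ω => x ω j) 4 P)
    (ENNReal.sum_ne_top.2 fun j _ => (hx4 j).2.ne) (iSup₂_le fun u hu => ?_)
  have he := eLpNorm_four_eq (P := P) fun ω => ∑ j, u j * x ω j
  simp only [ENNReal.rpow_ofNat] at he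
  rw [← he]
  have hsum : (fun ω => ∑ j, u j * x ω j) = ∑ j, fun ω => u j * x ω j := by
    ext ω; simp
  rw [hsum]
  refine (eLpNorm_sum_le (fun j _ => ((hx4 j).1.const_mul (u j))) (by norm_num)).trans
    (Finset.sum_le_sum fun j _ => ?_)
  refine eLpNorm_mono fun ω => ?_
  rw [norm_mul]
  exact mul_le_of_le_one_left (norm_nonneg _) ((PiLp.norm_apply_le u j).trans_eq hu)

/-- Homogeneity reduces a nonzero `u` to its normalization; the zero vector is separate. -/
theorem lintegral_linear_pow_four_le (x : Ω → Fin p → ℝ) (P : Measure Ω) (u : Fin p → ℝ) :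
    ∫⁻ ω, ‖∑ j, u j * x ω j‖ₑ ^ 4 ∂P
      ≤ unifFourthMoment x P ^ 4 * ENNReal.ofReal (∑ j, u j ^ 2) ^ 2 := by
  set s := Real.sqrt (∑ j, u j ^ 2) with hs
  have h0 : 0 ≤ ∑ j, u j ^ 2 := Finset.sum_nonneg fun _ _ => sq_nonneg _
  rcases h0.eq_or_lt with h | h
  · have hu : ∀ j, u j = 0 := fun j => by
      have := (Finset.sum_eq_zero_iff_of_nonneg fun _ _ => sq_nonneg _).1 h.symm j
        (Finset.mem_univ j)
      exact pow_eq_zero_iff (two_ne_zero) |>.1 this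
    simp [hu]
  have hs0 : 0 < s := Real.sqrt_pos.2 h
  have hs2 : s ^ 2 = ∑ j, u j ^ 2 := Real.sq_sqrt h0
  let v : EuclideanSpace ℝ (Fin p) := WithLp.toLp 2 fun j => u j / s
  have hv : ‖v‖ = 1 := by
    rw [EuclideanSpace.norm_eq, Real.sqrt_eq_one]
    simp only [v, Real.norm_eq_abs, sq_abs, div_pow]
    rw [← Finset.sum_div, hs2, div_self h.ne']
  have hle : (∫⁻ ω, ‖∑ j, v j * x ω j‖ₑ ^ 4 ∂P) ^ (1 / 4 : ℝ) ≤ unifFourthMoment x P :=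
    le_iSup₂ (f := fun (u : EuclideanSpace ℝ (Fin p)) (_ : ‖u‖ = 1) =>
      (∫⁻ ω, ‖∑ j, u j * x ω j‖ₑ ^ 4 ∂P) ^ (1 / 4 : ℝ)) v hv
  have hle4 := ENNReal.rpow_le_rpow hle (show (0 : ℝ) ≤ 4 by norm_num)
  rw [← ENNReal.rpow_mul] at hle4
  norm_num at hle4
  have hsu : ∀ ω, ‖∑ j, u j * x ω j‖ₑ ^ 4 = ENNReal.ofReal s ^ 4 * ‖∑ j, v j * x ω j‖ₑ ^ 4 := by
    intro ω
    rw [← mul_pow, ← Real.enorm_of_nonneg hs0.le, ← enorm_mul, Finset.mul_sum]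
    congr 2
    refine Finset.sum_congr rfl fun j _ => ?_
    simp only [v]
    field_simp
  simp only [hsu]
  rw [lintegral_const_mul' _ _ (by simp), mul_comm, ← hs2, ENNReal.ofReal_pow hs0.le, ← pow_mul]
  gcongr

theorem lintegral_norm_pow_four_ne_top [NeZero p] {x : Ω → Fin p → ℝ} {P : Measure Ω}
    (hx4 : ∀ j, MemLp (fun ω => x ω j) 4 P) : ∫⁻ ω, ‖x ω‖ₑ ^ 4 ∂P ≠ ⊤ := by
  have hle : ∀ ω, ‖x ω‖ₑ ^ 4 ≤ ∑ j, ‖x ω j‖ₑ ^ (4 : ℝ) := fun ω => by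
    obtain ⟨j, hj⟩ := exists_enorm_apply_eq (x ω)
    rw [hj, ← ENNReal.rpow_ofNat]
    exact Finset.single_le_sum (f := fun j => ‖x ω j‖ₑ ^ (4 : ℝ)) (fun _ _ => zero_le)
      (Finset.mem_univ j)
  refine ne_top_of_le_ne_top ?_ (lintegral_mono hle)
  rw [lintegral_finsetSum' _ fun j _ => (hx4 j).1.enorm.pow_const _]
  exact ENNReal.sum_ne_top.2 fun j _ => ne_top_of_le_ne_top
    (ENNReal.rpow_ne_top_of_nonneg (by norm_num) (diagMoment_four_ne_top hx4))
    (lintegral_rpow_le_diagMoment (by norm_num) j)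

/-- Jensen moves the power `r` inside the expectation, where the maximum is at most the sum over `n
* p` coordinates, each contributing at most μ_{4r}^{4r}; then the root of order `2 * r` is taken. -/
theorem expMaxFourth_rpow_le [NeZero p] {x : Ω → Fin p → ℝ} {P : Measure Ω} {P' : Measure Ω'}
    [IsProbabilityMeasure P'] {X : Fin n → Ω' → Fin p → ℝ} (hid : ∀ i, IdentDistrib (X i) x P' P)
    {r : ℝ} (hr : 1 ≤ r) :
    expMaxFourth X P' ^ (1 / 2 : ℝ)
      ≤ ((n : ℝ≥0∞) * (p : ℝ≥0∞)) ^ (1 / (2 * r)) * diagMoment x P (4 * r) ^ 2 := by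
  have hr0 : 0 < r := by linarith
  have hXm : ∀ i, AEMeasurable (X i) P' := fun i => (hid i).aemeasurable_fst
  have hXj : ∀ i j, ∫⁻ ω, ‖X i ω j‖ₑ ^ (4 * r) ∂P' ≤ diagMoment x P (4 * r) ^ (4 * r) := by
    intro i j
    have hm : Measurable fun y : Fin p → ℝ => ‖y j‖ₑ ^ (4 * r) :=
      (measurable_pi_apply j).enorm.pow_const _
    have := ((hid i).comp hm).lintegral_eq
    simp only [Function.comp_def] at this
    rw [this]
    exact lintegral_rpow_le_diagMoment (by positivity) j
  have hpt : ∀ ω, (⨆ i, ‖X i ω‖ₑ ^ 4) ^ r ≤ ∑ i, ∑ j, ‖X i ω j‖ₑ ^ (4 * r) := by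
    intro ω
    rw [← ENNReal.le_rpow_inv_iff hr0]
    refine iSup_le fun i => ?_
    rw [ENNReal.le_rpow_inv_iff hr0]
    obtain ⟨j, hj⟩ := exists_enorm_apply_eq (X i ω)
    rw [hj, ← ENNReal.rpow_ofNat, ← ENNReal.rpow_mul]
    exact (Finset.single_le_sum (f := fun j => ‖X i ω j‖ₑ ^ (4 * r)) (fun _ _ => zero_le)
      (Finset.mem_univ j)).trans
      (Finset.single_le_sum (f := fun i => ∑ j, ‖X i ω j‖ₑ ^ (4 * r)) (fun _ _ => zero_le)
      (Finset.mem_univ i))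
  have hXij : ∀ i j, AEMeasurable (fun ω => ‖X i ω j‖ₑ ^ (4 * r)) P' := fun i j =>
    ((measurable_pi_apply j).comp_aemeasurable (hXm i)).enorm.pow_const _
  have hmain : expMaxFourth X P' ^ r ≤ (n * p) * diagMoment x P (4 * r) ^ (4 * r) := by
    calc expMaxFourth X P' ^ r ≤ ∫⁻ ω, (⨆ i, ‖X i ω‖ₑ ^ 4) ^ r ∂P' :=
          rpow_lintegral_le P' (AEMeasurable.iSup fun i => (hXm i).enorm.pow_const 4) hr
      _ ≤ ∫⁻ ω, ∑ i, ∑ j, ‖X i ω j‖ₑ ^ (4 * r) ∂P' := lintegral_mono hpt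
      _ = ∑ i, ∑ j, ∫⁻ ω, ‖X i ω j‖ₑ ^ (4 * r) ∂P' := by
          rw [lintegral_finsetSum' _ fun i _ => Finset.aemeasurable_fun_sum _ fun j _ => hXij i j]
          exact Finset.sum_congr rfl fun i _ => lintegral_finsetSum' _ fun j _ => hXij i j
      _ ≤ ∑ _i : Fin n, ∑ _j : Fin p, diagMoment x P (4 * r) ^ (4 * r) :=
          Finset.sum_le_sum fun i _ => Finset.sum_le_sum fun j _ => hXj i j
      _ = _ := by simp [mul_assoc]
  have := ENNReal.rpow_le_rpow hmain (show 0 ≤ 1 / (2 * r) by positivity)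
  rw [← ENNReal.rpow_mul, ENNReal.mul_rpow_of_nonneg _ _ (by positivity), ← ENNReal.rpow_mul] at this
  have e1 : r * (1 / (2 * r)) = 1 / 2 := by field_simp
  have e2 : 4 * r * (1 / (2 * r)) = 2 := by field_simp; norm_num
  rw [e1, e2, ENNReal.rpow_ofNat] at this
  exact this

end Moments

/-! ### Assembly of the main estimate -/

/-- The bound on the second moment of the error of the masked sample covariance estimator. -/
theorem lintegral_maskedSampleCov_sq_le {p n : ℕ} (hp : 3 ≤ p) (hn : 1 ≤ n)
    (M : Matrix (Fin p) (Fin p) ℝ) (hM : M.IsSymm)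
    {Ω : Type*} [MeasurableSpace Ω] (P : Measure Ω) [IsProbabilityMeasure P]
    (x : Ω → Fin p → ℝ)
    (hx4 : ∀ j, MemLp (fun ω => x ω j) 4 P)
    {Ω' : Type*} [MeasurableSpace Ω'] (P' : Measure Ω') [IsProbabilityMeasure P']
    (X : Fin n → Ω' → Fin p → ℝ)
    (hind : iIndepFun X P')
    (hid : ∀ i, IdentDistrib (X i) x P' P) :
    (∫⁻ ω, ‖M ⊙ sampleCov (fun i => X i ω) - M ⊙ covMatrix x P‖ₑ ^ 2 ∂P')
        ^ (1 / 2 : ℝ)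
      ≤ ENNReal.ofReal (Real.sqrt (8 * Real.exp 1 * Real.log p / n))
          * ENNReal.ofReal (normOneTwo M)
          * (diagMoment x P 4 * unifFourthMoment x P)
        + ENNReal.ofReal (8 * Real.exp 1 * Real.log p / n) * ‖M‖ₑ
          * expMaxFourth X P' ^ (1 / 2 : ℝ) := by
  have : NeZero p := ⟨by omega⟩
  have hn0 : (0 : ℝ) < n := by exact_mod_cast hn
  have hlog : 0 ≤ Real.log p := Real.log_natCast_nonneg _
  have hxm : AEMeasurable x P := (hid ⟨0, hn⟩).aemeasurable_snd
  have hXm : ∀ i, AEMeasurable (X i) P' := fun i => (hid i).aemeasurable_fst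
  set ν := P.map x with hν
  have : IsProbabilityMeasure ν := Measure.isProbabilityMeasure_map hxm
  -- By independence the sample has a product law, so the estimate can be carried out on the product
  -- space.
  have hXπ : P'.map (fun ω i => X i ω) = Measure.pi fun _ : Fin n => ν := by
    rw [(iIndepFun_iff_map_fun_eq_pi_map hXm).1 hind]
    congr 1
    funext i
    exact (hid i).map_eq
  have hXm' : AEMeasurable (fun ω i => X i ω) P' := aemeasurable_pi_lambda _ hXm
  set Z := maskedRankOne M with hZ
  have hZc : Continuous Z := continuous_maskedRankOne M
  have h4 : ∫⁻ y, ‖y‖ₑ ^ 4 ∂ν ≠ ⊤ := by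
    rw [hν, lintegral_map' (by fun_prop) hxm]
    exact lintegral_norm_pow_four_ne_top hx4
  have hZsq : ∀ y, ‖Z y‖ₑ ^ 2 ≤ ‖M‖ₑ ^ 2 * ‖y‖ₑ ^ 4 := fun y => by
    refine (pow_le_pow_left' (enorm_maskedRankOne_le M y) 2).trans_eq ?_
    rw [mul_pow, ← pow_mul]
  have hZ2 : ∫⁻ y, ‖Z y‖ₑ ^ 2 ∂ν ≠ ⊤ := by
    refine ne_top_of_le_ne_top ?_ (lintegral_mono hZsq)
    rw [lintegral_const_mul' _ _ (by simp)]
    exact ENNReal.mul_ne_top (by simp) h4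
  have hZL : MemLp Z 2 ν := by
    refine ⟨hZc.aestronglyMeasurable, ?_⟩
    rw [eLpNorm_lt_top_iff_lintegral_rpow_enorm_lt_top (by norm_num) (by norm_num)]
    simpa using hZ2.lt_top
  have hZi : Integrable Z ν := hZL.integrable (by norm_num)
  have hZ2i : Integrable (fun y => Z y * Z y) ν := hZL.integrable_mul hZL
  have hEZ : M ⊙ covMatrix x P = ∫ y, Z y ∂ν := by
    ext i j
    rw [integral_matrix_apply hZi, hν, integral_map hxm]
    · simp [covMatrix, hZ, maskedRankOne, Matrix.vecMulVec_apply, integral_const_mul]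
    · simp only [hZ, maskedRankOne, Matrix.hadamard_apply, Matrix.vecMulVec_apply]
      fun_prop
  have hdiff : ∀ v : Fin n → Fin p → ℝ, M ⊙ sampleCov v - M ⊙ covMatrix x P
      = (1 / (n : ℝ)) • ∑ i, (Z (v i) - ∫ y, Z y ∂ν) := by
    intro v
    have h1 : M ⊙ sampleCov v = (1 / (n : ℝ)) • ∑ i, Z (v i) := by
      ext i j
      simp only [sampleCov, hZ, maskedRankOne, Matrix.hadamard_apply, Matrix.smul_apply,
        Matrix.sum_apply, smul_eq_mul, ← Finset.mul_sum]
      ring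
    rw [h1, hEZ, Finset.sum_sub_distrib, smul_sub]
    congr 1
    rw [Finset.sum_const, Finset.card_univ, Fintype.card_fin, ← Nat.cast_smul_eq_nsmul ℝ, smul_smul,
      one_div, inv_mul_cancel₀ hn0.ne', one_smul]
  set π := Measure.pi fun _ : Fin n => ν with hπ
  set c : ℝ := 2 * Real.exp 1 * Real.log p with hc
  have hc0 : 0 ≤ c := by positivity
  set F := expMaxFourth X P' with hF
  have hFπ : ∫⁻ y, ⨆ i, ‖y i‖ₑ ^ 4 ∂π = F := by
    rw [← hXπ, lintegral_map' _ hXm']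
    · rfl
    · exact (Measurable.iSup fun i => (measurable_pi_apply i).enorm.pow_const 4).aemeasurable
  have hG : (∫⁻ y, ⨆ i, ‖Z (y i)‖ₑ ^ 2 ∂π) ^ (1 / 2 : ℝ) ≤ ‖M‖ₑ * F ^ (1 / 2 : ℝ) := by
    have : ∫⁻ y, ⨆ i, ‖Z (y i)‖ₑ ^ 2 ∂π ≤ ‖M‖ₑ ^ 2 * F := by
      rw [← hFπ, ← lintegral_const_mul' _ _ (by simp)]
      refine lintegral_mono fun y => iSup_le fun i => (hZsq (y i)).trans ?_
      gcongr
      exact le_iSup (fun i => ‖y i‖ₑ ^ 4) i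
    refine (ENNReal.rpow_le_rpow this (by norm_num)).trans_eq ?_
    rw [ENNReal.mul_rpow_of_nonneg _ _ (by norm_num), ← ENNReal.rpow_natCast, ← ENNReal.rpow_mul]
    norm_num
  set D := diagMoment x P 4 with hD
  set H := unifFourthMoment x P with hH
  have hDt : D ≠ ⊤ := diagMoment_four_ne_top hx4
  have hHt : H ≠ ⊤ := unifFourthMoment_ne_top hx4
  have hK : ‖∫ y, Z y * Z y ∂ν‖ₑ ≤ (ENNReal.ofReal (normOneTwo M) * (D * H)) ^ 2 := by
    have := norm_integral_maskedRankOne_sq_le ν hM hZ2i (D := D.toNNReal) (H := H.toNNReal)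
      (fun j => by
        rw [ENNReal.coe_toNNReal hDt, hν,
          lintegral_map' ((measurable_pi_apply j).enorm.pow_const 4).aemeasurable hxm]
        simpa using lintegral_rpow_le_diagMoment (x := x) (P := P) (r := 4) (by norm_num) j)
      (fun u => by
        rw [ENNReal.coe_toNNReal hHt, hν,
          lintegral_map' (Measurable.aemeasurable (by fun_prop)) hxm]
        exact lintegral_linear_pow_four_le x P u)
    have := ENNReal.ofReal_le_ofReal this
    rwa [ofReal_norm, ENNReal.ofReal_pow (mul_nonneg (normOneTwo_nonneg M) (by positivity)),
      ENNReal.ofReal_mul (normOneTwo_nonneg M), ENNReal.ofReal_mul (by positivity),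
      ENNReal.ofReal_coe_nnreal, ENNReal.ofReal_coe_nnreal, ENNReal.coe_toNNReal hDt,
      ENNReal.coe_toNNReal hHt] at this
  have hros := matrix_rosenthal (ι := Fin n) ν hZc.stronglyMeasurable
    (maskedRankOne_isSymm hM) hZi hZ2 (by simpa using hp)
  rw [Fintype.card_fin, Fintype.card_fin, ← hc] at hros
  have hT : (∫⁻ ω, ‖M ⊙ sampleCov (fun i => X i ω) - M ⊙ covMatrix x P‖ₑ ^ 2 ∂P') ^ (1 / 2 : ℝ)
      = ENNReal.ofReal (1 / n)
        * (∫⁻ y, ‖∑ i, (Z (y i) - ∫ y, Z y ∂ν)‖ₑ ^ (2 : ℝ) ∂π) ^ (1 / 2 : ℝ) := by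
    have hm : Measurable fun y : Fin n → Fin p → ℝ => ‖∑ i, (Z (y i) - ∫ y, Z y ∂ν)‖ₑ ^ (2 : ℝ) := by
      refine Measurable.pow_const (Continuous.measurable ?_) _
      exact (continuous_finsetSum _ fun i _ =>
        (hZc.comp (continuous_apply i)).sub continuous_const).enorm
    rw [← hXπ, lintegral_map' hm.aemeasurable hXm']
    simp only [hdiff, enorm_smul, mul_pow]
    rw [lintegral_const_mul' _ _ (by simp), ENNReal.mul_rpow_of_nonneg _ _ (by norm_num),
      ← ENNReal.rpow_natCast, ← ENNReal.rpow_mul, Real.enorm_of_nonneg (by positivity)]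
    norm_num
  have hroot : ∀ t : ℝ, 0 ≤ t → ENNReal.ofReal t ^ (1 / 2 : ℝ) = ENNReal.ofReal (Real.sqrt t) :=
    fun t ht => by rw [ENNReal.ofReal_rpow_of_nonneg ht (by norm_num), Real.sqrt_eq_rpow]
  have h4c : 4 * ENNReal.ofReal c = ENNReal.ofReal (4 * c) := by
    rw [ENNReal.ofReal_mul (p := 4) (q := c) (by norm_num), ENNReal.ofReal_ofNat]
  rw [hT]
  refine (mul_le_mul_right (hros.trans (add_le_add (mul_le_mul_right (ENNReal.rpow_le_rpow
    (mul_le_mul_right hK _) (by norm_num)) _) (mul_le_mul_right hG _))) _).trans_eq ?_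
  -- Since 4c = 8e log p, the factors 1/n, √(4c) and √n combine to √(8e log p / n).
  have e1 : ENNReal.ofReal (1 / n) * (ENNReal.ofReal (Real.sqrt (4 * c))
      * ENNReal.ofReal (Real.sqrt n))
      = ENNReal.ofReal (Real.sqrt (8 * Real.exp 1 * Real.log p / n)) := by
    rw [← ENNReal.ofReal_mul (by positivity), ← ENNReal.ofReal_mul (by positivity)]
    congr 1
    have : 8 * Real.exp 1 * Real.log p = 4 * c := by rw [hc]; ring
    rw [this, Real.sqrt_div (by positivity)]
    have hsn : Real.sqrt n ^ 2 = n := Real.sq_sqrt hn0.le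
    have hsn0 : Real.sqrt n ≠ 0 := (Real.sqrt_pos.2 hn0).ne'
    rw [← hsn]
    simp only [Real.sqrt_sq (Real.sqrt_nonneg _)]
    field_simp
  have e2 : ENNReal.ofReal (1 / n) * ENNReal.ofReal (4 * c)
      = ENNReal.ofReal (8 * Real.exp 1 * Real.log p / n) := by
    rw [← ENNReal.ofReal_mul (by positivity)]
    congr 1
    rw [hc]; ring
  rw [h4c, hroot _ (by positivity), ENNReal.mul_rpow_of_nonneg _ _ (by norm_num),
    ← ENNReal.ofReal_natCast n, hroot _ hn0.le, ← ENNReal.rpow_natCast, ← ENNReal.rpow_mul, mul_add,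
    ← e1, ← e2]
  norm_num
  ring

end MaskedCov

theorem mainTheorem1 {p n : ℕ} (hp : 3 ≤ p) (hn : 1 ≤ n)
    (M : Matrix (Fin p) (Fin p) ℝ) (hM : M.IsSymm)
    {Ω : Type*} [MeasurableSpace Ω] (P : Measure Ω) [IsProbabilityMeasure P]
    (x : Ω → Fin p → ℝ)
    (hx4 : ∀ j, MemLp (fun ω => x ω j) 4 P)
    (hx0 : ∀ j, ∫ ω, x ω j ∂P = 0)
    {Ω' : Type*} [MeasurableSpace Ω'] (P' : Measure Ω') [IsProbabilityMeasure P']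
    (X : Fin n → Ω' → Fin p → ℝ)
    (hind : iIndepFun X P')
    (hid : ∀ i, IdentDistrib (X i) x P' P) :
    (∫⁻ ω, ‖M ⊙ MaskedCov.sampleCov (fun i => X i ω) - M ⊙ MaskedCov.covMatrix x P‖ₑ ^ 2 ∂P')
        ^ (1 / 2 : ℝ)
      ≤ ENNReal.ofReal (Real.sqrt (8 * Real.exp 1 * Real.log p / n))
          * ENNReal.ofReal (MaskedCov.normOneTwo M)
          * (MaskedCov.diagMoment x P 4 * MaskedCov.unifFourthMoment x P)
        + ENNReal.ofReal (8 * Real.exp 1 * Real.log p / n) * ‖M‖ₑ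
          * MaskedCov.expMaxFourth X P' ^ (1 / 2 : ℝ)
    ∧ MaskedCov.expMaxFourth X P' ^ (1 / 2 : ℝ)
      ≤ ⨅ (r : ℝ) (_ : 1 ≤ r),
          ((n : ℝ≥0∞) * (p : ℝ≥0∞)) ^ (1 / (2 * r)) * MaskedCov.diagMoment x P (4 * r) ^ 2 := by
  have : NeZero p := ⟨by omega⟩
  exact ⟨MaskedCov.lintegral_maskedSampleCov_sq_le hp hn M hM P x hx4 P' X hind hid,
    le_iInf₂ fun r hr => MaskedCov.expMaxFourth_rpow_le hid hr⟩
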